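/- Let $W=\{w_{i,j}: i,j\ge 1\}$ be an infinite array of independent $\mathcal N(0,1)$ random variables on a probability space, let $W_n=(w_{i,j})_{1\le i,j\le n}$ be its $n\times n$ upper left corner, and fix $\tau>0$. A $k\times k$ submatrix of $W_n$ is given by sets $A,B\subseteq\{1,\dots,n\}$ (not necessarily contiguous) with $|A|=|B|=k$, and its average is $\frac{1}{|A||B|}\sum_{i\in A,\,j\in B}w_{i,j}$. Let $K_\tau(W_n)$ be the largest $k$ such that $W_n$ contains a $k\times k$ submatrix with average at least $\tau$ (and $K_\tau(W_n)=0$ if there is no such $k\ge 1$). For $0<s<n$ put $$\phi_{n,\tau}(s)=(2\pi)^{-1/2}\,n^{n+1/2}\,s^{-s-1/2}\,(n-s)^{-(n-s)-1/2}\,e^{-\tau^2s^2/4}.$$ Then for all sufficiently large $n$ the equation $\phi_{n,\tau}(s)=1$ has exactly one root $s=s(n,\tau)$ in $(0,n-1]$; as $n\to\infty$, $$s(n,\tau)=\frac{4}{\tau^2}\ln n-\frac{4}{\tau^2}\ln\Big(\frac{4}{\tau^2}\ln n\Big)+\frac{4}{\tau^2}+o(1);$$ and, with probability one, for all sufficiently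 large $n$, $$s(n,\tau)-\frac{4}{\tau^2}-\frac{12\ln 2}{\tau^2}-4\ \le\ K_\tau(W_n)\ \le\ s(n,\tau)+2 .$$ -/

import Mathlib

open Filter Topology MeasureTheory ProbabilityTheory

noncomputable section

/-- The average of the entries of the submatrix of `M` with row set `A` and column set `B`. -/
def submatrixAvg {n : ℕ} (M : Matrix (Fin n) (Fin n) ℝ) (A B : Finset (Fin n)) : ℝ :=
  (∑ i ∈ A, ∑ j ∈ B, M i j) / ((A.card : ℝ) * (B.card : ℝ))

/-- `M` contains a `k × k` submatrix (rows and columns need not be contiguous) whose average is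
at least `τ`. -/
def HasLargeAvg {n : ℕ} (τ : ℝ) (M : Matrix (Fin n) (Fin n) ℝ) (k : ℕ) : Prop :=
  ∃ A B : Finset (Fin n), A.card = k ∧ B.card = k ∧ τ ≤ submatrixAvg M A B

/-- The largest `k` such that `M` contains a `k × k` submatrix with average at least `τ`;
it is `0` if there is no such `k ≥ 1` (all such `k` are at most `n`). -/
def largestAvg {n : ℕ} (τ : ℝ) (M : Matrix (Fin n) (Fin n) ℝ) : ℕ :=
  sSup {k : ℕ | HasLargeAvg τ M k}

/-- The `n × n` upper left corner of an infinite array. -/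
def corner (x : ℕ → ℕ → ℝ) (n : ℕ) : Matrix (Fin n) (Fin n) ℝ :=
  Matrix.of fun i j => x i j

/-- The Stirling-type function
`(2π)^(-1/2) n^(n+1/2) s^(-s-1/2) (n-s)^(-(n-s)-1/2) e^(-τ²s²/4)`, used for `0 < s < n`. -/
def phiFun (n : ℕ) (τ s : ℝ) : ℝ :=
  (2 * Real.pi) ^ (-(1 / 2) : ℝ) * (n : ℝ) ^ ((n : ℝ) + 1 / 2) * s ^ (-s - 1 / 2)
    * ((n : ℝ) - s) ^ (-((n : ℝ) - s) - 1 / 2) * Real.exp (-(τ ^ 2 * s ^ 2 / 4))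

/-- `s` is a positive root of `phiFun n τ s = 1`. The range is `(0, n - 1]` and not `(0, n)`,
because `phiFun n τ s` tends to infinity as `s` tends to `n`, which creates a spurious second
root extremely close to `n`. -/
def IsThreshold (n : ℕ) (τ s : ℝ) : Prop :=
  0 < s ∧ s ≤ (n : ℝ) - 1 ∧ phiFun n τ s = 1

end

/-!
Write `a = 4 / τ ^ 2` and `T n = a ln n - a ln (a ln n) + a` (`thresholdApprox`).

*The threshold.* On `(0, (a / 2) ln n]` the logarithm of `phiFun` is positive
(`eventually_logPhi_pos`), on `[(a / 2) ln n, n - 1]` it is strictly decreasing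
(`logPhi_strictAntiOn`), and at `n - 1` it is negative, which gives existence and uniqueness of
the root. Along any sequence `u n` equivalent to `a ln n`, the quotient `ln φ(u) / u` is
`ln n - ln (a ln n) + 1 - u / a + o(1)` (`tendsto_logPhi_div`), so for each `ε > 0` the sign of
`ln φ` is eventually positive at `T n - ε` and negative at `T n + ε`, whence `s n - T n → 0`.
From there on only `T n` matters, and `phiFun` plays no further role.

*The upper bound* is a union bound. The expected number of `k × k` submatrices with average at
least `τ` is at most `(C(n, k) e ^ (-τ² k² / 4)) ^ 2` (`measure_hasLargeAvg_le`), which is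
at most `n ^ (-3)` as soon as `k ≥ T n + 1.9`; sum over the `k ≤ n` and use Borel-Cantelli.

*The lower bound* is the second moment method for the number of such submatrices. Two submatrices
with `r` common rows and `l` common columns are independent if `r l = 0`; otherwise Chernoff's
bound for the sum of the two totals gives joint probability at most
`exp (-τ² k⁴ / (k² + r l))`, to be compared with the square of a Gaussian tail. With `x = r / k`
and `y = l / k` the resulting exponent `τ² k² x y / (1 + x y)` splits into a function of `r` and
a function of `l` because `x y / (1 + x y)` is at most the mean of `x² / (1 + x²)` and
`y² / (1 + y²)` (`mul_div_one_add_mul_le`). The sum over pairs of submatrices is then the square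
of a sum over `r` alone (`measure_not_hasLargeAvg_le`). When `k` is at most
`T n - a (1 + 3 ln 2) - 2.9` but within a bounded distance of `T n`, every one of its terms is at most `n ^ (-3 / 4)`
(`overlap_term_le`), so the failure probabilities are summable and Borel-Cantelli applies again.
-/

/-! ### Sums of independent standard Gaussian variables -/

section GaussianSums
variable {Ω ι : Type*} [MeasurableSpace Ω] {P : Measure Ω}
  {X : ι → Ω → ℝ}

theorem hasLaw_sum_gaussianReal [IsProbabilityMeasure P]
    (hX : ∀ i, HasLaw (X i) (gaussianReal 0 1) P) (hind : iIndepFun X P) (S : Finset ι) :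
    HasLaw (fun ω => ∑ i ∈ S, X i ω) (gaussianReal 0 S.card) P := by
  classical
  induction S using Finset.induction_on with
  | empty =>
    refine ⟨by simp [aemeasurable_const], ?_⟩
    simp
  | insert i S hi ih =>
    have hI : IndepFun (X i) (fun ω => ∑ j ∈ S, X j ω) P := by
      have := hind.indepFun_finsetSum_of_notMem₀ (fun j => (hX j).aemeasurable) hi
      simpa [Finset.sum_fn] using this.symm
    have h := gaussianReal_add_gaussianReal_of_indepFun hI (hX i).map_eq ih.map_eq
    simp only [Finset.sum_insert hi, Finset.card_insert_of_notMem hi]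
    have e : ((S.card + 1 : ℕ) : NNReal) = 1 + (S.card : NNReal) := by push_cast; ring
    rw [e]
    refine ⟨(hX i).aemeasurable.add ih.aemeasurable, ?_⟩
    simpa using! h

theorem weighted_sum_tail_le (hX : ∀ i, HasLaw (X i) (gaussianReal 0 1) P)
    (hind : iIndepFun X P) (S : Finset ι) (c : ι → ℝ) {t : ℝ} (ht : 0 ≤ t) :
    P.real {ω | t ≤ ∑ i ∈ S, c i * X i ω} ≤ Real.exp (-t ^ 2 / (2 * ∑ i ∈ S, c i ^ 2)) := by
  have h1 : ∀ i, HasSubgaussianMGF (X i) 1 P := fun i => by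
    refine ⟨fun t => ?_, fun t => ?_⟩
    · have h := integrable_exp_mul_gaussianReal (μ := 0) (v := 1) t
      rw [← (hX i).map_eq] at h
      exact h.comp_aemeasurable (hX i).aemeasurable
    · rw [mgf_gaussianReal (hX i).map_eq]
      simp
  have h2 : iIndepFun (fun i ω => c i * X i ω) P :=
    hind.comp (fun i x => c i * x) (fun i => by fun_prop)
  have h3 := HasSubgaussianMGF.measure_sum_ge_le_of_iIndepFun h2 (s := S)
    (fun i _ => (h1 i).const_mul (c i)) ht
  have e : ∑ i ∈ S, (((.mk (c i ^ 2) (sq_nonneg (c i)) : NNReal) * 1 : NNReal) : ℝ)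
      = ∑ i ∈ S, c i ^ 2 := Finset.sum_congr rfl fun i _ => by rw [mul_one]; rfl
  rw [← e]
  exact_mod_cast h3

/-- If both sums are at least `t` then their total, in which each variable has weight `0`, `1` or
`2`, is at least `2 * t`; Chernoff's bound applies to that total. -/
theorem joint_tail_le [IsProbabilityMeasure P] (hX : ∀ i, HasLaw (X i) (gaussianReal 0 1) P)
    (hind : iIndepFun X P) [DecidableEq ι] (S T : Finset ι) {t : ℝ} (ht : 0 ≤ t) :
    P.real {ω | t ≤ ∑ i ∈ S, X i ω ∧ t ≤ ∑ i ∈ T, X i ω} ≤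
      Real.exp (-(2 * t ^ 2 / (S.card + T.card + 2 * (S ∩ T).card))) := by
  -- `c i` counts in how many of `S` and `T` the index `i` lies.
  set c : ι → ℝ := fun i => (if i ∈ S then 1 else 0) + (if i ∈ T then 1 else 0) with hc
  have hS : ∀ f : ι → ℝ, ∑ i ∈ S ∪ T, (if i ∈ S then f i else 0) = ∑ i ∈ S, f i := fun f => by
    rw [← Finset.sum_filter]
    congr 1; ext i; simp +contextual
  have hT : ∀ f : ι → ℝ, ∑ i ∈ S ∪ T, (if i ∈ T then f i else 0) = ∑ i ∈ T, f i := fun f => by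
    rw [← Finset.sum_filter]
    congr 1; ext i; simp +contextual
  have hST : ∀ f : ι → ℝ, ∑ i ∈ S ∪ T, (if i ∈ S ∩ T then f i else 0) = ∑ i ∈ S ∩ T, f i :=
    fun f => by
      rw [← Finset.sum_filter]
      congr 1; ext i; simp +contextual
  have h := weighted_sum_tail_le hX hind (S ∪ T) c (t := 2 * t) (by linarith)
  have hv : ∑ i ∈ S ∪ T, c i ^ 2 = S.card + T.card + 2 * (S ∩ T).card := by
    have : ∀ i, c i ^ 2 = (if i ∈ S then 1 else 0) + (if i ∈ T then 1 else 0)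
        + 2 * (if i ∈ S ∩ T then 1 else 0) := fun i => by
      by_cases h1 : i ∈ S <;> by_cases h2 : i ∈ T <;> (simp [hc, h1, h2]; try norm_num)
    simp_rw [this, Finset.sum_add_distrib, ← Finset.mul_sum]
    rw [hS (fun _ => 1), hT (fun _ => 1), hST (fun _ => 1)]
    simp
  rw [hv] at h
  refine (measureReal_mono ?_).trans (h.trans_eq ?_)
  · rintro ω ⟨h1, h2⟩
    have : ∑ i ∈ S ∪ T, c i * X i ω = ∑ i ∈ S, X i ω + ∑ i ∈ T, X i ω := by
      rw [← hS, ← hT, ← Finset.sum_add_distrib]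
      refine Finset.sum_congr rfl fun i _ => ?_
      simp [hc, add_mul]
    simp only [Set.mem_ofPred_eq, this]
    linarith
  · congr 1
    rcases eq_or_ne ((S.card : ℝ) + T.card + 2 * (S ∩ T).card) 0 with h0 | h0
    · simp [h0]
    · field_simp

/-- Lower bound of the right order for the upper tail of a centred Gaussian of standard deviation
`k`: the mass of `[t, t + k ^ 2 / t]`, on which the density is at least `e ^ (-3 / 2)` times its
value at `t`. -/
theorem sum_tail_ge [IsProbabilityMeasure P] (hX : ∀ i, HasLaw (X i) (gaussianReal 0 1) P)
    (hind : iIndepFun X P) (S : Finset ι) {k t : ℝ} (hk : 0 < k) (hS : (S.card : ℝ) = k ^ 2)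
    (ht : k ≤ t) :
    Real.exp (-(3 / 2)) / √(2 * Real.pi) * (k / t) * Real.exp (-(t ^ 2 / (2 * k ^ 2))) ≤
      P.real {ω | t ≤ ∑ i ∈ S, X i ω} := by
  have hlaw := hasLaw_sum_gaussianReal hX hind S
  have htp : 0 < t := hk.trans_le ht
  have hne : (S.card : NNReal) ≠ 0 := by
    intro h0
    have : (S.card : ℝ) = 0 := by exact_mod_cast h0
    rw [this] at hS
    exact (pow_pos hk 2).ne hS
  have e1 : P.real {ω | t ≤ ∑ i ∈ S, X i ω} = (gaussianReal 0 S.card).real (Set.Ici t) :=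
    hlaw.measureReal_eq (p := fun x => t ≤ x) measurableSet_Ici
  set m : ℝ := k ^ 2 / t with hm
  have hmp : 0 < m := by positivity
  set d : ℝ := (√(2 * Real.pi * k ^ 2))⁻¹ * Real.exp (-((t + m) ^ 2) / (2 * k ^ 2)) with hd
  have e2 : m * d ≤ (gaussianReal 0 S.card).real (Set.Icc t (t + m)) := by
    rw [measureReal_def, gaussianReal_apply_eq_integral _ hne,
      ENNReal.toReal_ofReal (integral_nonneg fun x => gaussianPDFReal_nonneg _ _ _)]
    have : ∫ x in Set.Icc t (t + m), d = m * d := by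
      simp [measureReal_def, hmp.le]
    rw [← this]
    refine setIntegral_mono_on (by simp) (integrable_gaussianPDFReal _ _).integrableOn
      measurableSet_Icc fun x hx => ?_
    rw [gaussianPDFReal_def]
    simp only [NNReal.coe_natCast, hS, sub_zero, hd]
    gcongr
    · linarith [hx.1]
    · exact hx.2
  rw [e1]
  refine le_trans ?_ (e2.trans (measureReal_mono fun x hx => hx.1))
  have e3 : √(2 * Real.pi * k ^ 2) = √(2 * Real.pi) * k := by
    rw [Real.sqrt_mul (by positivity), Real.sqrt_sq hk.le]
  have e4 : Real.exp (-(3 / 2)) * Real.exp (-(t ^ 2 / (2 * k ^ 2))) ≤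
      Real.exp (-((t + m) ^ 2) / (2 * k ^ 2)) := by
    rw [← Real.exp_add, Real.exp_le_exp]
    have : -((t + m) ^ 2) / (2 * k ^ 2) = -(t ^ 2 / (2 * k ^ 2)) - 1 - (k / t) ^ 2 / 2 := by
      rw [hm]; field_simp; ring
    have h1 : (k / t) ^ 2 ≤ 1 := by
      apply pow_le_one₀ (by positivity)
      rwa [div_le_one htp]
    rw [this]; linarith
  calc _ = (k / t) * (√(2 * Real.pi))⁻¹ *
        (Real.exp (-(3 / 2)) * Real.exp (-(t ^ 2 / (2 * k ^ 2)))) := by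
        rw [div_eq_mul_inv]; ring
    _ ≤ (k / t) * (√(2 * Real.pi))⁻¹ * Real.exp (-((t + m) ^ 2) / (2 * k ^ 2)) := by gcongr
    _ = m * d := by
        rw [hd, e3, hm]; field_simp

theorem joint_tail_of_disjoint (hX : ∀ i, HasLaw (X i) (gaussianReal 0 1) P)
    (hind : iIndepFun X P) {S T : Finset ι} (hST : Disjoint S T) (t : ℝ) :
    P.real {ω | t ≤ ∑ i ∈ S, X i ω ∧ t ≤ ∑ i ∈ T, X i ω} =
      P.real {ω | t ≤ ∑ i ∈ S, X i ω} * P.real {ω | t ≤ ∑ i ∈ T, X i ω} := by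
  have h := (hind.indepFun_finset₀ S T hST (fun i => (hX i).aemeasurable)).comp
    (φ := fun f : S → ℝ => ∑ i, f i) (ψ := fun f : T → ℝ => ∑ i, f i)
    (by fun_prop) (by fun_prop)
  have h' := h.measure_inter_preimage_eq_mul (Set.Ici t) (Set.Ici t) measurableSet_Ici
    measurableSet_Ici
  have eS : (fun f : S → ℝ => ∑ i, f i) ∘ (fun a (i : S) => X i a) = fun ω => ∑ i ∈ S, X i ω := by
    funext ω; exact Finset.sum_coe_sort S fun i => X i ω
  have eT : (fun f : T → ℝ => ∑ i, f i) ∘ (fun a (i : T) => X i a) = fun ω => ∑ i ∈ T, X i ω := by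
    funext ω; exact Finset.sum_coe_sort T fun i => X i ω
  rw [eS, eT] at h'
  simp only [measureReal_def, ← ENNReal.toReal_mul]
  exact congrArg ENNReal.toReal h'

theorem nullMeasurableSet_tail (hX : ∀ i, HasLaw (X i) (gaussianReal 0 1) P) (S : Finset ι)
    (t : ℝ) : NullMeasurableSet {ω | t ≤ ∑ i ∈ S, X i ω} P :=
  nullMeasurableSet_le aemeasurable_const
    (Finset.aemeasurable_fun_sum S fun i _ => (hX i).aemeasurable)

end GaussianSums

/-! ### The second moment method and overlaps of random subsets -/

/-- Chebyshev's inequality for the number of the events `E a` that occur. The events have the same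
probability `p`, and `q a b` bounds the relative excess of the joint probabilities over `p ^ 2`. -/
theorem measure_forall_notMem_le_of_second_moment {Ω α : Type*} [MeasurableSpace Ω]
    {P : Measure Ω} [IsProbabilityMeasure P]
    {I : Finset α} (hI : I.Nonempty) {E : α → Set Ω} (hE : ∀ a, NullMeasurableSet (E a) P)
    {p : ℝ} (hp0 : 0 < p) (hp : ∀ a ∈ I, P.real (E a) = p) {q : α → α → ℝ}
    (hq : ∀ a ∈ I, ∀ b ∈ I, P.real (E a ∩ E b) ≤ p ^ 2 * (1 + q a b)) {Q : ℝ}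
    (hQ : ∀ a ∈ I, ∑ b ∈ I, q a b ≤ Q * I.card) :
    P.real {ω | ∀ a ∈ I, ω ∉ E a} ≤ Q := by
  set N : ℝ := I.card * p with hN
  have hcard : (0 : ℝ) < I.card := by exact_mod_cast hI.card_pos
  have hNp : 0 < N := by positivity
  set F : Set Ω := {ω | ∀ a ∈ I, ω ∉ E a} with hF
  have hFE : F = ⋂ a ∈ I, (E a)ᶜ := by ext ω; simp [hF]
  have hFm : NullMeasurableSet F P := by
    rw [hFE]; exact Finset.nullMeasurableSet_biInter I fun a _ => (hE a).compl
  have int1 : ∀ A : Set Ω, NullMeasurableSet A P →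
      Integrable (A.indicator (fun _ => (1 : ℝ))) P := fun A hA =>
    (integrable_const 1).indicator₀ hA
  have val1 : ∀ A : Set Ω, NullMeasurableSet A P →
      ∫ ω, A.indicator (fun _ => (1 : ℝ)) ω ∂P = P.real A := fun A hA => by
    rw [integral_indicator₀ hA]; simp
  set Z : Ω → ℝ := fun ω => ∑ a ∈ I, (E a).indicator (fun _ => (1 : ℝ)) ω with hZ
  have hZ2 : ∀ ω, (Z ω) ^ 2 = ∑ a ∈ I, ∑ b ∈ I, (E a ∩ E b).indicator (fun _ => (1 : ℝ)) ω := by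
    intro ω
    rw [hZ, sq, Finset.sum_mul_sum]
    refine Finset.sum_congr rfl fun a _ => Finset.sum_congr rfl fun b _ => ?_
    by_cases h1 : ω ∈ E a <;> by_cases h2 : ω ∈ E b <;> simp [h1, h2]
  have intZ : Integrable Z P := integrable_finsetSum _ fun a _ => int1 _ (hE a)
  have intZ2 : Integrable (fun ω => Z ω ^ 2) P := by
    simp_rw [hZ2]
    exact integrable_finsetSum _ fun a _ => integrable_finsetSum _ fun b _ =>
      int1 _ ((hE a).inter (hE b))
  have valZ : ∫ ω, Z ω ∂P = N := by
    rw [hZ, integral_finsetSum _ fun a _ => int1 _ (hE a)]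
    rw [Finset.sum_congr rfl fun a ha => (val1 _ (hE a)).trans (hp a ha)]
    simp [hN]
  have valZ2 : ∫ ω, Z ω ^ 2 ∂P ≤ N ^ 2 + N ^ 2 * Q := by
    simp_rw [hZ2]
    rw [integral_finsetSum _ fun a _ => integrable_finsetSum _ fun b _ =>
      int1 _ ((hE a).inter (hE b))]
    calc _ = ∑ a ∈ I, ∑ b ∈ I, P.real (E a ∩ E b) := by
          refine Finset.sum_congr rfl fun a _ => ?_
          rw [integral_finsetSum _ fun b _ => int1 _ ((hE a).inter (hE b))]
          exact Finset.sum_congr rfl fun b _ => val1 _ ((hE a).inter (hE b))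
      _ ≤ ∑ a ∈ I, ∑ b ∈ I, p ^ 2 * (1 + q a b) :=
          Finset.sum_le_sum fun a ha => Finset.sum_le_sum fun b hb => hq a ha b hb
      _ = ∑ a ∈ I, p ^ 2 * (I.card + ∑ b ∈ I, q a b) := by
          simp [← Finset.mul_sum, Finset.sum_add_distrib]
      _ ≤ ∑ a ∈ I, p ^ 2 * (I.card + Q * I.card) := by
          gcongr with a ha; exact hQ a ha
      _ = _ := by simp [hN]; ring
  have key : ∫ ω, N ^ 2 * F.indicator (fun _ => (1 : ℝ)) ω ∂P ≤
      ∫ ω, (Z ω ^ 2 - 2 * N * Z ω + N ^ 2) ∂P := by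
    refine integral_mono ((int1 _ hFm).const_mul _)
      ((intZ2.sub (intZ.const_mul _)).add (integrable_const _)) fun ω => ?_
    by_cases h : ω ∈ F
    · have : Z ω = 0 := Finset.sum_eq_zero fun a ha => by simp [h a ha]
      simp [h, this]
    · simp only [h, not_false_eq_true, Set.indicator_of_notMem, mul_zero]
      nlinarith [sq_nonneg (Z ω - N)]
  have expand : ∫ ω, (Z ω ^ 2 - 2 * N * Z ω + N ^ 2) ∂P = ∫ ω, Z ω ^ 2 ∂P - 2 * N * N + N ^ 2 := by
    have h1 : ∫ ω, (Z ω ^ 2 - 2 * N * Z ω + N ^ 2) ∂P =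
        ∫ ω, (Z ω ^ 2 - 2 * N * Z ω) ∂P + ∫ _, N ^ 2 ∂P :=
      integral_add (intZ2.sub (intZ.const_mul _)) (integrable_const _)
    rw [h1, integral_sub intZ2 (intZ.const_mul _), integral_const_mul, valZ]
    simp
  rw [integral_const_mul, val1 _ hFm, expand] at key
  have : N ^ 2 * P.real F ≤ N ^ 2 * Q := by nlinarith
  exact le_of_mul_le_mul_left this (by positivity)

open Finset in
theorem card_powersetCard_superset_le {α : Type*} [Fintype α] [DecidableEq α] (k : ℕ)
    (R : Finset α) :
    #{A ∈ powersetCard k univ | R ⊆ A} ≤ (Fintype.card α - #R).choose (k - #R) := by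
  have : #(powersetCard (k - #R) (univ \ R)) = (Fintype.card α - #R).choose (k - #R) := by
    rw [card_powersetCard, card_sdiff_of_subset (subset_univ _), card_univ]
  rw [← this]
  refine card_le_card_of_injOn (· \ R) ?_ ?_
  · intro A hA
    simp only [coe_filter, mem_powersetCard, Set.mem_ofPred_eq] at hA
    simp only [mem_coe, mem_powersetCard]
    exact ⟨sdiff_subset_sdiff (subset_univ _) subset_rfl, by
      rw [card_sdiff_of_subset hA.2, hA.1.2]⟩
  · intro A hA B hB h
    simp only [coe_filter, mem_powersetCard, Set.mem_ofPred_eq] at hA hB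
    rw [← sdiff_union_of_subset hA.2, ← sdiff_union_of_subset hB.2]
    exact congrArg (· ∪ R) h

/-- A uniformly random `k`-subset of an `n`-set contains a given `r`-set with probability at most
`(k / n) ^ r`. -/
theorem choose_sub_mul_pow_le {n k r : ℕ} (hkn : k ≤ n) (hr : r ≤ k) :
    (n - r).choose (k - r) * n ^ r ≤ n.choose k * k ^ r := by
  induction r with
  | zero => simp
  | succ r ih =>
    have ih := ih (by omega)
    have h1 := Nat.add_one_mul_choose_eq (n - (r + 1)) (k - (r + 1))
    rw [show n - (r + 1) + 1 = n - r by omega, show k - (r + 1) + 1 = k - r by omega] at h1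
    have h2 : (k - r) * n ≤ (n - r) * k := by
      zify [show r ≤ k by omega, show r ≤ n by omega]
      nlinarith
    have hpos : 0 < n - r := by omega
    refine Nat.le_of_mul_le_mul_left (c := n - r) ?_ hpos
    calc (n - r) * ((n - (r + 1)).choose (k - (r + 1)) * n ^ (r + 1))
        = ((n - r).choose (k - r) * n ^ r) * ((k - r) * n) := by
          rw [← mul_assoc, h1, pow_succ]; ring
      _ ≤ (n.choose k * k ^ r) * ((n - r) * k) := Nat.mul_le_mul ih h2
      _ = _ := by rw [pow_succ]; ring

open Finset in
/-- Bounds the sum of `F` over the overlaps of a fixed `k`-set with all `k`-sets, by counting each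
`B` once for every subset `R` of `A ∩ B` instead of only for `R = A ∩ B`. -/
theorem sum_overlap_le {α : Type*} [Fintype α] [DecidableEq α] {k : ℕ}
    (hk : k ≤ Fintype.card α) (A : Finset α) (hA : #A = k) (F : ℕ → ℝ) (hF : ∀ r, 0 ≤ F r)
    (hF0 : F 0 = 0) :
    ∑ B ∈ powersetCard k univ, F #(A ∩ B) ≤ (Fintype.card α).choose k *
      ∑ r ∈ Icc 1 k, (k.choose r : ℝ) * ((k : ℝ) / Fintype.card α) ^ r * F r := by
  set n := Fintype.card α with hn
  calc ∑ B ∈ powersetCard k univ, F #(A ∩ B)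
      ≤ ∑ B ∈ powersetCard k univ, ∑ R ∈ A.powerset, if R ⊆ B then F #R else 0 := by
        refine sum_le_sum fun B _ => ?_
        have := single_le_sum (f := fun R : Finset α => if R ⊆ B then F #R else 0)
          (s := A.powerset) (fun R _ => by split_ifs <;> simp [hF])
          (mem_powerset.2 (inter_subset_left : A ∩ B ⊆ A))
        simpa using this
    _ = ∑ R ∈ A.powerset, #{B ∈ powersetCard k univ | R ⊆ B} * F #R := by
        rw [sum_comm]
        refine sum_congr rfl fun R _ => ?_
        rw [← sum_filter, sum_const, nsmul_eq_mul]
    _ ≤ ∑ R ∈ A.powerset, ((n - #R).choose (k - #R) : ℝ) * F #R := by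
        refine sum_le_sum fun R _ => mul_le_mul_of_nonneg_right ?_ (hF _)
        exact_mod_cast card_powersetCard_superset_le k R
    _ = ∑ r ∈ range (k + 1), (k.choose r : ℝ) * (((n - r).choose (k - r) : ℝ) * F r) := by
        rw [sum_powerset, hA]
        refine sum_congr rfl fun r _ => ?_
        rw [sum_congr rfl (g := fun _ => ((n - r).choose (k - r) : ℝ) * F r) fun R hR => by
          rw [(mem_powersetCard.1 hR).2]]
        simp [hA]
    _ = ∑ r ∈ Icc 1 k, (k.choose r : ℝ) * (((n - r).choose (k - r) : ℝ) * F r) := by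
        symm
        refine sum_subset (fun r hr => by simp at hr ⊢; omega) fun r hr hr' => ?_
        have : r = 0 := by simp at hr hr'; omega
        simp [this, hF0]
    _ ≤ ∑ r ∈ Icc 1 k, (n.choose k : ℝ) * ((k.choose r : ℝ) * ((k : ℝ) / n) ^ r * F r) := by
        refine sum_le_sum fun r hr => ?_
        rw [mem_Icc] at hr
        have hnp : (0 : ℝ) < n := by exact_mod_cast (by omega : 0 < n)
        have : ((n - r).choose (k - r) : ℝ) ≤ n.choose k * ((k : ℝ) / n) ^ r := by
          rw [div_pow, ← mul_div_assoc, le_div_iff₀ (by positivity)]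
          exact_mod_cast choose_sub_mul_pow_le hk hr.2
        calc _ ≤ (k.choose r : ℝ) * ((n.choose k * ((k : ℝ) / n) ^ r) * F r) := by
              gcongr; exact hF r
          _ = _ := by ring
    _ = _ := by rw [mul_sum]

/-- Separates the two overlaps: the difference of the two sides is a nonnegative multiple of
`(x - y) ^ 2 * (1 - x * y)`. -/
theorem mul_div_one_add_mul_le {x y : ℝ} (hx : 0 ≤ x) (hy : 0 ≤ y) (hxy : x * y ≤ 1) :
    x * y / (1 + x * y) ≤ (x ^ 2 / (1 + x ^ 2) + y ^ 2 / (1 + y ^ 2)) / 2 := by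
  have hxy0 : 0 ≤ x * y := mul_nonneg hx hy
  have key : (x ^ 2 / (1 + x ^ 2) + y ^ 2 / (1 + y ^ 2)) / 2 - x * y / (1 + x * y) =
      (x - y) ^ 2 * (1 - x * y) / (2 * (1 + x ^ 2) * (1 + y ^ 2) * (1 + x * y)) := by
    have : 1 + x * y ≠ 0 := by positivity
    field_simp
    ring
  have : 0 ≤ (x - y) ^ 2 * (1 - x * y) / (2 * (1 + x ^ 2) * (1 + y ^ 2) * (1 + x * y)) := by
    have : 0 ≤ 1 - x * y := by linarith
    positivity
  linarith

/-! ### Probability bounds for a single submatrix size -/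

section Matrix
variable {Ω : Type*} [MeasurableSpace Ω] {P : Measure Ω} [IsProbabilityMeasure P] {n : ℕ}
  {X : Fin n × Fin n → Ω → ℝ}

theorem le_submatrixAvg_iff {M : Matrix (Fin n) (Fin n) ℝ} {A B : Finset (Fin n)} {k : ℕ}
    (hk : 1 ≤ k) (hA : A.card = k) (hB : B.card = k) (τ : ℝ) :
    τ ≤ submatrixAvg M A B ↔ τ * (k : ℝ) ^ 2 ≤ ∑ p ∈ A ×ˢ B, M p.1 p.2 := by
  have : (0 : ℝ) < k := by exact_mod_cast hk
  rw [submatrixAvg, hA, hB, le_div_iff₀ (by positivity), Finset.sum_product, sq]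

theorem measure_hasLargeAvg_le (hX : ∀ i, HasLaw (X i) (gaussianReal 0 1) P)
    (hind : iIndepFun X P) {τ : ℝ} (hτ : 0 < τ) {k : ℕ} (hk : 1 ≤ k) :
    P.real {ω | HasLargeAvg τ (Matrix.of fun i j => X (i, j) ω) k} ≤
      ((n.choose k : ℝ) * Real.exp (-(τ ^ 2 * (k : ℝ) ^ 2 / 4))) ^ 2 := by
  have hkp : (0 : ℝ) < k := by exact_mod_cast hk
  set I := Finset.powersetCard k (Finset.univ : Finset (Fin n)) with hI
  have hcI : I.card = n.choose k := by simp [hI]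
  have hsub : {ω | HasLargeAvg τ (Matrix.of fun i j => X (i, j) ω) k} ⊆
      ⋃ p ∈ I ×ˢ I, {ω | τ * (k : ℝ) ^ 2 ≤ ∑ i ∈ p.1 ×ˢ p.2, X i ω} := by
    rintro ω ⟨A, B, hA, hB, h⟩
    rw [le_submatrixAvg_iff hk hA hB] at h
    simp only [Set.mem_iUnion]
    exact ⟨(A, B), by simp [hI, hA, hB], by simpa using h⟩
  calc _ ≤ P.real (⋃ p ∈ I ×ˢ I, {ω | τ * (k : ℝ) ^ 2 ≤ ∑ i ∈ p.1 ×ˢ p.2, X i ω}) :=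
        measureReal_mono hsub (measure_ne_top _ _)
    _ ≤ ∑ p ∈ I ×ˢ I, P.real {ω | τ * (k : ℝ) ^ 2 ≤ ∑ i ∈ p.1 ×ˢ p.2, X i ω} :=
        measureReal_biUnion_finset_le _ _
    _ ≤ ∑ p ∈ I ×ˢ I, Real.exp (-(τ ^ 2 * (k : ℝ) ^ 2 / 2)) := by
        refine Finset.sum_le_sum fun p hp => ?_
        simp only [hI, Finset.mem_product, Finset.mem_powersetCard] at hp
        have h := weighted_sum_tail_le hX hind (p.1 ×ˢ p.2) (fun _ => 1)
          (t := τ * (k : ℝ) ^ 2) (by positivity)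
        simp only [one_mul, one_pow, Finset.sum_const, Finset.card_product, hp.1.2, hp.2.2] at h
        refine h.trans_eq ?_
        congr 1
        push_cast [nsmul_eq_mul]
        field_simp
    _ = _ := by
        rw [Finset.sum_const, Finset.card_product, hcI, mul_pow, ← Real.exp_nat_mul, nsmul_eq_mul]
        push_cast
        rw [← sq]
        congr 2
        ring

/-- The second moment bound for the absence of `k × k` submatrices with large average. The prefactor
`τ * k / (e ^ (-3 / 2) / √(2π))` is the loss in the lower bound for the Gaussian tail, and the
index `r` is the number of common rows (or columns) of two submatrices. -/
theorem measure_not_hasLargeAvg_le (hX : ∀ i, HasLaw (X i) (gaussianReal 0 1) P)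
    (hind : iIndepFun X P) {τ : ℝ} (hτ : 0 < τ) {k : ℕ} (hk : 1 ≤ k) (hkn : k ≤ n)
    (hτk : 1 ≤ τ * k) :
    P.real {ω | ¬ HasLargeAvg τ (Matrix.of fun i j => X (i, j) ω) k} ≤
      (τ * k / (Real.exp (-(3 / 2)) / √(2 * Real.pi)) *
        ∑ r ∈ Finset.Icc 1 k, (k.choose r : ℝ) * ((k : ℝ) / n) ^ r *
          Real.exp (τ ^ 2 * (k : ℝ) ^ 2 * ((r : ℝ) ^ 2 / ((k : ℝ) ^ 2 + (r : ℝ) ^ 2)) / 2)) ^ 2 := by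
  have hkp : (0 : ℝ) < k := by exact_mod_cast hk
  set c : ℝ := Real.exp (-(3 / 2)) / √(2 * Real.pi) with hc
  have hcp : 0 < c := by positivity
  set J := Finset.powersetCard k (Finset.univ : Finset (Fin n)) with hJ
  have hcJ : J.card = n.choose k := by simp [hJ]
  have hmem : ∀ A ∈ J, A.card = k := fun A hA => (Finset.mem_powersetCard.1 hA).2
  set t : ℝ := τ * (k : ℝ) ^ 2 with ht
  have htp : 0 < t := by positivity
  set E : Finset (Fin n) × Finset (Fin n) → Set Ω := fun p => {ω | t ≤ ∑ i ∈ p.1 ×ˢ p.2, X i ω}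
    with hE
  set F : ℕ → ℝ := fun r => if r = 0 then 0 else
    Real.exp (τ ^ 2 * (k : ℝ) ^ 2 * ((r : ℝ) ^ 2 / ((k : ℝ) ^ 2 + (r : ℝ) ^ 2)) / 2) with hF
  have hFnn : ∀ r, 0 ≤ F r := fun r => by
    simp only [hF]; split_ifs <;> positivity
  set S : ℝ := ∑ r ∈ Finset.Icc 1 k, (k.choose r : ℝ) * ((k : ℝ) / n) ^ r * F r with hS
  have hSeq : S = ∑ r ∈ Finset.Icc 1 k, (k.choose r : ℝ) * ((k : ℝ) / n) ^ r *
          Real.exp (τ ^ 2 * (k : ℝ) ^ 2 * ((r : ℝ) ^ 2 / ((k : ℝ) ^ 2 + (r : ℝ) ^ 2)) / 2) := by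
    refine Finset.sum_congr rfl fun r hr => ?_
    have : r ≠ 0 := by simp at hr; omega
    simp [hF, this]
  have hlaw : ∀ S : Finset (Fin n × Fin n), S.card = k ^ 2 →
      P.real {ω | t ≤ ∑ i ∈ S, X i ω} = (gaussianReal 0 (k ^ 2 : ℕ)).real (Set.Ici t) :=
    fun S hS => by
      have h := (hasLaw_sum_gaussianReal hX hind S)
      rw [hS] at h
      exact h.measureReal_eq (p := fun x => t ≤ x) measurableSet_Ici
  set p : ℝ := (gaussianReal 0 (k ^ 2 : ℕ)).real (Set.Ici t) with hp
  have hcard : ∀ a ∈ J ×ˢ J, (a.1 ×ˢ a.2).card = k ^ 2 := fun a ha => by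
    rw [Finset.mem_product] at ha
    rw [Finset.card_product, hmem _ ha.1, hmem _ ha.2, sq]
  have hJne : (J ×ˢ J).Nonempty := by
    have : J.Nonempty := Finset.card_pos.1 (hcJ ▸ Nat.choose_pos hkn)
    exact this.product this
  have hplow : c / (τ * k) * Real.exp (-(τ ^ 2 * (k : ℝ) ^ 2 / 2)) ≤ p := by
    obtain ⟨a, ha⟩ := hJne
    have h := sum_tail_ge hX hind (a.1 ×ˢ a.2) hkp (by rw [hcard a ha]; push_cast; rfl) (t := t)
      (by rw [ht]; nlinarith)
    rw [hlaw _ (hcard a ha)] at h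
    refine le_trans (le_of_eq ?_) h
    rw [ht]
    congr 1
    · rw [← hc]; field_simp
    · congr 1; field_simp
  have hp0 : 0 < p := lt_of_lt_of_le (by positivity) hplow
  set D : ℝ := (τ * k / c) ^ 2 with hD
  have hjoint : ∀ a ∈ J ×ˢ J, ∀ b ∈ J ×ˢ J, P.real (E a ∩ E b) ≤
      p ^ 2 * (1 + D * (F (a.1 ∩ b.1).card * F (a.2 ∩ b.2).card)) := by
    intro a ha b hb
    have hinter : (a.1 ×ˢ a.2) ∩ (b.1 ×ˢ b.2) = (a.1 ∩ b.1) ×ˢ (a.2 ∩ b.2) :=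
      Finset.product_inter_product
    set r := (a.1 ∩ b.1).card with hr
    set l := (a.2 ∩ b.2).card with hl
    -- Without a common row or without a common column the two submatrices share no entry.
    by_cases h0 : r = 0 ∨ l = 0
    · have hdisj : Disjoint (a.1 ×ˢ a.2) (b.1 ×ˢ b.2) := by
        rw [Finset.disjoint_iff_inter_eq_empty, hinter, ← Finset.card_eq_zero,
          Finset.card_product]
        exact mul_eq_zero.2 h0
      have h := joint_tail_of_disjoint hX hind hdisj t
      rw [hlaw _ (hcard a ha), hlaw _ (hcard b hb)] at h
      have hz : F r * F l = 0 := by rcases h0 with h0 | h0 <;> simp [hF, h0]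
      rw [hz]
      refine (le_of_eq h).trans (le_of_eq ?_)
      ring
    · push Not at h0
      have hrk : r ≤ k := by
        rw [Finset.mem_product] at ha
        exact (Finset.card_le_card Finset.inter_subset_left).trans (hmem _ ha.1).le
      have hlk : l ≤ k := by
        rw [Finset.mem_product] at ha
        exact (Finset.card_le_card Finset.inter_subset_left).trans (hmem _ ha.2).le
      have hrk' : (r : ℝ) ≤ k := by exact_mod_cast hrk
      have hlk' : (l : ℝ) ≤ k := by exact_mod_cast hlk
      have h := joint_tail_le hX hind (a.1 ×ˢ a.2) (b.1 ×ˢ b.2) htp.le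
      rw [hinter, hcard a ha, hcard b hb, Finset.card_product, ← hr, ← hl] at h
      refine (show P.real (E a ∩ E b) ≤ _ from h).trans ?_
      have hlow2 : (c / (τ * k)) ^ 2 * Real.exp (-(τ ^ 2 * (k : ℝ) ^ 2)) ≤ p ^ 2 := by
        calc _ = (c / (τ * k) * Real.exp (-(τ ^ 2 * (k : ℝ) ^ 2 / 2))) ^ 2 := by
              rw [mul_pow, ← Real.exp_nat_mul]; congr 2; push_cast; ring
          _ ≤ p ^ 2 := by gcongr
      have hFF : F r * F l = Real.exp (τ ^ 2 * (k : ℝ) ^ 2 *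
          (((r / k : ℝ) ^ 2 / (1 + (r / k : ℝ) ^ 2) +
            (l / k : ℝ) ^ 2 / (1 + (l / k : ℝ) ^ 2)) / 2)) := by
        simp only [hF, h0.1, h0.2, if_false, ← Real.exp_add]
        congr 1
        field_simp
      have hx := mul_div_one_add_mul_le (x := (r / k : ℝ)) (y := (l / k : ℝ)) (by positivity)
        (by positivity) (mul_le_one₀ (by rwa [div_le_one hkp]) (by positivity)
          (by rwa [div_le_one hkp]))
      calc Real.exp (-(2 * t ^ 2 / (((k ^ 2 : ℕ) : ℝ) + ((k ^ 2 : ℕ) : ℝ) + 2 * ((r * l : ℕ) : ℝ))))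
          = Real.exp (-(τ ^ 2 * (k : ℝ) ^ 2)) * Real.exp (τ ^ 2 * (k : ℝ) ^ 2 *
            ((r / k : ℝ) * (l / k : ℝ) / (1 + (r / k : ℝ) * (l / k : ℝ)))) := by
            rw [← Real.exp_add, ht]
            congr 1
            push_cast
            field_simp
            ring
        _ ≤ Real.exp (-(τ ^ 2 * (k : ℝ) ^ 2)) * (F r * F l) := by
            rw [hFF]; gcongr
        _ = ((c / (τ * k)) ^ 2 * Real.exp (-(τ ^ 2 * (k : ℝ) ^ 2))) * (D * (F r * F l)) := by
            rw [hD]; field_simp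
        _ ≤ p ^ 2 * (D * (F r * F l)) := by
            have := hFnn r; have := hFnn l
            gcongr
        _ ≤ _ := by nlinarith [sq_nonneg p]
  have hsum : ∀ a ∈ J ×ˢ J, ∑ b ∈ J ×ˢ J, D * (F (a.1 ∩ b.1).card * F (a.2 ∩ b.2).card) ≤
      (τ * k / c * S) ^ 2 * (J ×ˢ J).card := by
    intro a ha
    rw [Finset.mem_product] at ha
    have hk' : k ≤ Fintype.card (Fin n) := by simpa using hkn
    have h1 := sum_overlap_le hk' a.1 (hmem _ ha.1) F hFnn (by simp [hF])
    have h2 := sum_overlap_le hk' a.2 (hmem _ ha.2) F hFnn (by simp [hF])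
    rw [Fintype.card_fin] at h1 h2
    rw [← Finset.mul_sum, Finset.sum_product]
    dsimp only
    rw [← Finset.sum_mul_sum, Finset.card_product, hcJ]
    have h0 : 0 ≤ ∑ B ∈ J, F (a.2 ∩ B).card := Finset.sum_nonneg fun _ _ => hFnn _
    calc _ ≤ D * (((n.choose k : ℝ) * S) * ((n.choose k : ℝ) * S)) := by
          have : 0 ≤ (n.choose k : ℝ) * S :=
            (Finset.sum_nonneg fun _ _ => hFnn _).trans h1
          gcongr
      _ = _ := by rw [hD]; push_cast; ring
  have h := measure_forall_notMem_le_of_second_moment hJne (E := E)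
    (fun a => nullMeasurableSet_tail hX _ t) hp0
    (fun a ha => hlaw _ (hcard a ha)) hjoint hsum
  rw [← hSeq]
  refine le_trans (measureReal_mono ?_) h
  intro ω hω a ha hEa
  apply hω
  rw [Finset.mem_product] at ha
  refine ⟨a.1, a.2, hmem _ ha.1, hmem _ ha.2, ?_⟩
  rw [le_submatrixAvg_iff hk (hmem _ ha.1) (hmem _ ha.2)]
  simpa [hE, ht] using hEa

end Matrix

/-! ### The threshold -/

/-- The logarithm of `phiFun`, with `4 / τ ^ 2` replaced by `a` and `n` by a real variable. -/
noncomputable def logPhi (N a s : ℝ) : ℝ :=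
  -(Real.log (2 * Real.pi) / 2) + (N + 1 / 2) * Real.log N - (s + 1 / 2) * Real.log s
    - (N - s + 1 / 2) * Real.log (N - s) - s ^ 2 / a

/-- The explicit approximation `a ln n - a ln (a ln n) + a` of the threshold, where
`a = 4 / τ ^ 2`. -/
noncomputable def thresholdApprox (a : ℝ) (n : ℕ) : ℝ :=
  a * Real.log n - a * Real.log (a * Real.log n) + a

theorem phiFun_eq_exp_logPhi {n : ℕ} {τ s : ℝ} (hs : 0 < s) (hsn : s < n) :
    phiFun n τ s = Real.exp (logPhi n (4 / τ ^ 2) s) := by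
  have hn : (0 : ℝ) < n := hs.trans hsn
  rw [phiFun, Real.rpow_def_of_pos (by positivity), Real.rpow_def_of_pos hn,
    Real.rpow_def_of_pos hs, Real.rpow_def_of_pos (sub_pos.2 hsn), ← Real.exp_add, ← Real.exp_add,
    ← Real.exp_add, ← Real.exp_add, logPhi]
  congr 1
  rw [div_div_eq_mul_div]
  ring

theorem isThreshold_iff {n : ℕ} {τ s : ℝ} :
    IsThreshold n τ s ↔ 0 < s ∧ s ≤ (n : ℝ) - 1 ∧ logPhi n (4 / τ ^ 2) s = 0 := by
  refine and_congr_right fun h1 => and_congr_right fun h2 => ?_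
  rw [phiFun_eq_exp_logPhi h1 (by linarith), Real.exp_eq_one_iff]

theorem tendsto_log_log_mul_div_log {c : ℝ} (hc : 0 < c) :
    Tendsto (fun N : ℝ => Real.log (c * Real.log N) / Real.log N) atTop (𝓝 0) := by
  have h : Tendsto (fun x : ℝ => Real.log (c * x) / x) atTop (𝓝 0) := by
    have h1 : Tendsto (fun x : ℝ => Real.log c / x + Real.log x / x) atTop (𝓝 (0 + 0)) :=
      (tendsto_const_nhds.div_atTop tendsto_id).add
        (Real.isLittleO_log_id_atTop.tendsto_div_nhds_zero)
    rw [add_zero] at h1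
    refine h1.congr' ?_
    filter_upwards [eventually_gt_atTop 0] with x hx
    rw [Real.log_mul hc.ne' hx.ne']
    ring
  exact h.comp Real.tendsto_log_atTop

/-- There is no root in the initial range, in which `logPhi` is not monotone. -/
theorem eventually_logPhi_pos {a : ℝ} (ha : 0 < a) :
    ∀ᶠ N : ℝ in atTop, ∀ s, 0 < s → s ≤ a / 2 * Real.log N → 0 < logPhi N a s := by
  have hlog := Real.tendsto_log_atTop
  set C := Real.log (2 * Real.pi) / 2 with hC
  have e1 : ∀ᶠ N : ℝ in atTop, a / 2 * Real.log N < N := by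
    have h : Tendsto (fun N : ℝ => Real.log N / N) atTop (𝓝 0) :=
      Real.isLittleO_log_id_atTop.tendsto_div_nhds_zero
    filter_upwards [h.eventually_lt_const (show (0 : ℝ) < 2 / a by positivity),
      eventually_gt_atTop 0] with N h1 h2
    rw [div_lt_div_iff₀ h2 ha] at h1
    linarith
  have e2 : ∀ᶠ N : ℝ in atTop, 2 * C ≤ Real.log (1 / 2 * Real.log N) :=
    (Real.tendsto_log_atTop.comp (hlog.const_mul_atTop (by norm_num))).eventually_ge_atTop _
  have e3 : ∀ᶠ N : ℝ in atTop, 6 * Real.log (a / 2 * Real.log N) ≤ Real.log N := by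
    filter_upwards [(tendsto_log_log_mul_div_log (half_pos ha)).eventually_lt_const
      (show (0 : ℝ) < 1 / 6 by norm_num), hlog.eventually_gt_atTop 0] with N h1 h2
    rw [div_lt_iff₀ h2] at h1
    linarith
  filter_upwards [e1, e2, e3, hlog.eventually_gt_atTop (4 * C), hlog.eventually_gt_atTop 0] with
    N h1 h2 h3 h4 h5 s hs0 hs
  set ℓ := Real.log N with hℓ
  have hsN : s < N := hs.trans_lt h1
  have hN : 0 < N := hs0.trans hsN
  have hb : 0 ≤ (N - s + 1 / 2) * (ℓ - Real.log (N - s)) := by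
    refine mul_nonneg (by linarith) (sub_nonneg.2 (Real.log_le_log (by linarith) (by linarith)))
  have hq : s ^ 2 / a ≤ s * ℓ / 2 := by
    rw [div_le_iff₀ ha]
    nlinarith
  have hg : -C + s * ℓ / 2 - (s + 1 / 2) * Real.log s ≤ logPhi N a s := by
    rw [logPhi]; linarith
  refine lt_of_lt_of_le ?_ hg
  -- For `s ≤ 1` the divergence of `-(ln s) / 2` at `0` is needed; for `s ≥ 1` the term linear in
  -- `s` dominates.
  rcases le_total s 1 with h | h
  · have hls : Real.log s ≤ 0 := Real.log_nonpos hs0.le h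
    -- `ln v ≤ v - 1` at `v = s ℓ / 2` trades the linear term against `(ln s) / 2`.
    have hv : 0 < s * ℓ / 2 := by positivity
    have := Real.log_le_sub_one_of_pos hv
    rw [show s * ℓ / 2 = s * (1 / 2 * ℓ) by ring, Real.log_mul hs0.ne' (by positivity)] at this
    nlinarith
  · have hls : 0 ≤ Real.log s := Real.log_nonneg h
    have h6 : Real.log s ≤ ℓ / 6 := by
      have := Real.log_le_log hs0 hs
      linarith
    nlinarith

theorem logPhi_strictAntiOn {a N : ℝ} (ha : 0 < a) (hL : Real.exp 1 ≤ a / 2 * Real.log N) :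
    StrictAntiOn (logPhi N a) (Set.Icc (a / 2 * Real.log N) (N - 1)) := by
  have hd : ∀ s ∈ Set.Icc (a / 2 * Real.log N) (N - 1), HasDerivAt (logPhi N a)
      (0 - (1 * Real.log s + (s + 1 / 2) * (1 / s)) - ((-1) * Real.log (N - s)
        + (N - s + 1 / 2) * (-1 / (N - s))) - 2 * s / a) s := by
    intro s hs
    have hs0 : 0 < s := (Real.exp_pos 1).trans_le (hL.trans hs.1)
    have hsN : 0 < N - s := by linarith [hs.2]
    have d1 := ((hasDerivAt_id s).add_const (1 / 2 : ℝ)).mul ((hasDerivAt_id s).log hs0.ne')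
    have d2' := (hasDerivAt_id s).const_sub N
    have d2 := (d2'.add_const (1 / 2 : ℝ)).mul (d2'.log hsN.ne')
    have d3 := ((hasDerivAt_id s).pow 2).div_const a
    have := (((hasDerivAt_const s (-(Real.log (2 * Real.pi) / 2) + (N + 1 / 2) * Real.log N)).sub
      d1).sub d2).sub d3
    convert! this using 1
    simp
  refine strictAntiOn_of_deriv_neg (convex_Icc _ _)
    (fun s hs => (hd s hs).continuousAt.continuousWithinAt) fun s hs => ?_
  rw [(hd s (interior_subset hs)).deriv]
  rw [interior_Icc] at hs
  have hs0 : 0 < s := (Real.exp_pos 1).trans (hL.trans_lt hs.1)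
  have hsN : 1 < N - s := by linarith [hs.2]
  have h1 : 1 < Real.log s := by
    rw [Real.lt_log_iff_exp_lt hs0]; exact hL.trans_lt hs.1
  have h2 : Real.log (N - s) ≤ Real.log N := Real.log_le_log (by linarith) (by linarith)
  have h3 : Real.log N < 2 * s / a := by
    rw [lt_div_iff₀ ha]; linarith [hs.1]
  have h4 : (N - s + 1 / 2) * (-1 / (N - s)) = -1 - 1 / 2 * (1 / (N - s)) := by
    field_simp
    ring
  have h5 : (s + 1 / 2) * (1 / s) = 1 + 1 / 2 * (1 / s) := by field_simp
  have h6 : 0 < 1 / s := by positivity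
  have h7 : 1 / (N - s) < 1 := by rw [div_lt_one (by linarith)]; exact hsN
  rw [h4, h5]
  linarith

theorem logPhi_continuousOn (N a : ℝ) : ContinuousOn (logPhi N a) (Set.Ioo 0 N) := by
  unfold logPhi
  have h1 : ContinuousOn Real.log (Set.Ioo 0 N) :=
    Real.continuousOn_log.mono fun x hx => hx.1.ne'
  have h2 : ContinuousOn (fun s => Real.log (N - s)) (Set.Ioo 0 N) :=
    (by fun_prop : ContinuousOn (fun s : ℝ => N - s) (Set.Ioo 0 N)).log
      fun x hx => (sub_pos.2 hx.2).ne'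
  fun_prop

theorem eventually_logPhi_neg {a : ℝ} (ha : 0 < a) :
    ∀ᶠ N : ℝ in atTop, logPhi N a (N - 1) < 0 := by
  have h : Tendsto (fun N : ℝ => Real.log N / N) atTop (𝓝 0) :=
    Real.isLittleO_log_id_atTop.tendsto_div_nhds_zero
  filter_upwards [h.eventually_lt_const (show (0 : ℝ) < 1 / (8 * a) by positivity),
    eventually_ge_atTop 2] with N h1 h2
  rw [div_lt_div_iff₀ (by linarith) (by positivity)] at h1
  have hl : 0 ≤ Real.log N := Real.log_nonneg (by linarith)
  have hl1 : 0 ≤ Real.log (N - 1) := Real.log_nonneg (by linarith)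
  have hC : 0 ≤ Real.log (2 * Real.pi) := Real.log_nonneg (by linarith [Real.pi_gt_three])
  have h3 : (N + 1 / 2) * Real.log N < (N - 1) ^ 2 / a := by
    rw [lt_div_iff₀ ha]
    nlinarith
  rw [logPhi]
  simp only [sub_sub_cancel, Real.log_one]
  nlinarith

theorem tendsto_neg_log_one_sub_div {y : ℕ → ℝ} (hy : Tendsto y atTop (𝓝 0))
    (hpos : ∀ᶠ n in atTop, 0 < y n) :
    Tendsto (fun n => -Real.log (1 - y n) / y n) atTop (𝓝 1) := by
  have h1 : Tendsto (fun n => (1 - y n)⁻¹) atTop (𝓝 1) := by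
    have := (hy.const_sub 1).inv₀ (by norm_num)
    simpa using this
  refine tendsto_of_tendsto_of_tendsto_of_le_of_le' tendsto_const_nhds h1 ?_ ?_
  · filter_upwards [hpos, hy.eventually_lt_const one_pos] with n h2 h3
    rw [le_div_iff₀ h2]
    linarith [Real.log_le_sub_one_of_pos (sub_pos.2 h3)]
  · filter_upwards [hpos, hy.eventually_lt_const one_pos] with n h2 h3
    have h4 : 0 < 1 - y n := sub_pos.2 h3
    rw [div_le_iff₀ h2, ← Real.log_inv]
    refine (Real.log_le_sub_one_of_pos (inv_pos.2 h4)).trans_eq ?_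
    field_simp
    ring

/-- First-order behaviour of `logPhi` along sequences equivalent to `a ln n`, which contains the
threshold. -/
theorem tendsto_logPhi_div {a : ℝ} (ha : 0 < a) {u : ℕ → ℝ}
    (hu : Tendsto (fun n : ℕ => u n / (a * Real.log n)) atTop (𝓝 1)) :
    Tendsto (fun n : ℕ => logPhi n a (u n) / u n -
      (Real.log n - Real.log (a * Real.log n) + 1 - u n / a)) atTop (𝓝 0) := by
  have hlog : Tendsto (fun n : ℕ => a * Real.log n) atTop atTop :=
    (Real.tendsto_log_atTop.comp tendsto_natCast_atTop_atTop).const_mul_atTop ha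
  have hu_top : Tendsto u atTop atTop := by
    refine (hu.pos_mul_atTop one_pos hlog).congr' ?_
    filter_upwards [hlog.eventually_gt_atTop 0] with n hn
    exact div_mul_cancel₀ _ hn.ne'
  have hy : Tendsto (fun n : ℕ => u n / n) atTop (𝓝 0) := by
    have h1 : Tendsto (fun n : ℕ => Real.log n / n) atTop (𝓝 0) :=
      (Real.isLittleO_log_id_atTop.tendsto_div_nhds_zero).comp tendsto_natCast_atTop_atTop
    have h2 := hu.mul (h1.const_mul a)
    simp only [mul_zero] at h2
    refine h2.congr' ?_
    filter_upwards [hlog.eventually_gt_atTop 0] with n hn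
    have : Real.log n ≠ 0 := fun h => by simp [h] at hn
    field_simp
  have hypos : ∀ᶠ n : ℕ in atTop, 0 < u n / n := by
    filter_upwards [hu_top.eventually_gt_atTop 0, eventually_gt_atTop 0] with n h1 h2
    have : (0 : ℝ) < n := by exact_mod_cast h2
    positivity
  have t1 : Tendsto (fun n => -(Real.log (2 * Real.pi) / 2) / u n) atTop (𝓝 0) :=
    tendsto_const_nhds.div_atTop hu_top
  have t2 : Tendsto (fun n => Real.log (u n) / u n) atTop (𝓝 0) :=
    (Real.isLittleO_log_id_atTop.tendsto_div_nhds_zero).comp hu_top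
  have t3 : Tendsto (fun n : ℕ => Real.log (u n / (a * Real.log n))) atTop (𝓝 0) := by
    simpa using! (Real.continuousAt_log one_ne_zero).tendsto.comp hu
  have t4 : Tendsto (fun n : ℕ => (1 - u n / n + (1 / 2) / (n : ℝ)) *
      (-Real.log (1 - u n / n) / (u n / n))) atTop (𝓝 1) := by
    have h1 : Tendsto (fun n : ℕ => (1 / 2) / (n : ℝ)) atTop (𝓝 0) :=
      tendsto_const_nhds.div_atTop tendsto_natCast_atTop_atTop
    have := ((hy.const_sub 1).add h1).mul (tendsto_neg_log_one_sub_div hy hypos)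
    simpa using this
  have t := (((t1.add t4).sub (tendsto_const_nhds (x := (1 : ℝ)))).sub (t2.div_const 2)).sub t3
  simp only [zero_add, sub_self, zero_div] at t
  refine t.congr' ?_
  filter_upwards [hlog.eventually_gt_atTop 0, hu_top.eventually_gt_atTop 0,
    eventually_gt_atTop 0, hy.eventually_lt_const one_pos] with n h1 h2 h3 h4
  have hn : (0 : ℝ) < n := by exact_mod_cast h3
  rw [Real.log_div h2.ne' h1.ne']
  have h5 : (n : ℝ) - u n = n * (1 - u n / n) := by field_simp
  have h6 : 0 < 1 - u n / n := sub_pos.2 h4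
  have h7 : Real.log (n - u n) = Real.log n + Real.log (1 - u n / n) := by
    rw [h5, Real.log_mul hn.ne' h6.ne']
  rw [logPhi, h7]
  generalize Real.log (1 - u n / n) = x
  field_simp
  ring

theorem tendsto_thresholdApprox_add_div {a : ℝ} (ha : 0 < a) (c : ℝ) :
    Tendsto (fun n : ℕ => (thresholdApprox a n + c) / (a * Real.log n)) atTop (𝓝 1) := by
  have hlog : Tendsto (fun n : ℕ => Real.log n) atTop atTop :=
    Real.tendsto_log_atTop.comp tendsto_natCast_atTop_atTop
  have h1 := (tendsto_log_log_mul_div_log ha).comp (tendsto_natCast_atTop_atTop (R := ℝ))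
  have h2 : Tendsto (fun n : ℕ => ((a + c) / a) / Real.log n) atTop (𝓝 0) :=
    tendsto_const_nhds.div_atTop hlog
  have h := (h1.const_sub 1).add h2
  simp only [sub_zero, add_zero] at h
  refine h.congr' ?_
  filter_upwards [hlog.eventually_gt_atTop 0] with n hn
  simp only [Function.comp, thresholdApprox]
  field_simp
  ring

/-- The root is eventually trapped between `thresholdApprox a n - ε` and `thresholdApprox a n + ε`,
and both points lie in the range in which `logPhi` is strictly decreasing. -/
theorem eventually_logPhi_approx {a : ℝ} (ha : 0 < a) {ε : ℝ} (hε : 0 < ε) :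
    ∀ᶠ n : ℕ in atTop, 0 < logPhi n a (thresholdApprox a n - ε) ∧
      logPhi n a (thresholdApprox a n + ε) < 0 ∧
      a / 2 * Real.log n < thresholdApprox a n - ε ∧ thresholdApprox a n + ε < n - 1 := by
  have hlog : Tendsto (fun n : ℕ => a * Real.log n) atTop atTop :=
    (Real.tendsto_log_atTop.comp tendsto_natCast_atTop_atTop).const_mul_atTop ha
  have key : ∀ c : ℝ, Tendsto (fun n : ℕ => logPhi n a (thresholdApprox a n + c) /
      (thresholdApprox a n + c)) atTop (𝓝 (-c / a)) := by
    intro c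
    have h := (tendsto_logPhi_div ha (tendsto_thresholdApprox_add_div ha c)).add_const (-c / a)
    rw [zero_add] at h
    refine h.congr fun n => ?_
    rw [thresholdApprox]
    field_simp
    ring
  have hlow : ∀ c : ℝ, ∀ᶠ n : ℕ in atTop, a / 2 * Real.log n < thresholdApprox a n + c := by
    intro c
    filter_upwards [(tendsto_thresholdApprox_add_div ha c).eventually_const_lt
      (show (1 / 2 : ℝ) < 1 by norm_num), hlog.eventually_gt_atTop 0] with n h1 h2
    rw [lt_div_iff₀ h2] at h1
    linarith
  have hup : ∀ᶠ n : ℕ in atTop, thresholdApprox a n + ε < n - 1 := by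
    have h1 : Tendsto (fun n : ℕ => Real.log n / n) atTop (𝓝 0) :=
      (Real.isLittleO_log_id_atTop.tendsto_div_nhds_zero).comp tendsto_natCast_atTop_atTop
    filter_upwards [(tendsto_thresholdApprox_add_div ha ε).eventually_lt_const
      (show (1 : ℝ) < 2 by norm_num), hlog.eventually_gt_atTop 0,
      h1.eventually_lt_const (show (0 : ℝ) < 1 / (4 * a) by positivity),
      eventually_ge_atTop 2] with n h2 h3 h4 h5
    have hn : (2 : ℝ) ≤ n := by exact_mod_cast h5
    rw [div_lt_iff₀ h3] at h2
    rw [div_lt_div_iff₀ (by linarith) (by positivity)] at h4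
    linarith
  have kn := key (-ε)
  filter_upwards [(key ε).eventually_lt_const (u := 0) (div_neg_of_neg_of_pos (by linarith) ha),
    kn.eventually_const_lt (u := 0) (div_pos (by linarith) ha), hlow ε, hlow (-ε), hup,
    hlog.eventually_gt_atTop 0] with n h1 h2 h3 h4 h5 h6
  rw [← sub_eq_add_neg] at h2 h4
  refine ⟨?_, ?_, h4, h5⟩
  · exact (div_pos_iff_of_pos_right (by linarith)).1 h2
  · rw [div_neg_iff] at h1
    rcases h1 with h1 | h1
    · linarith [h1.2]
    · exact h1.1

theorem eventually_existsUnique_isThreshold {τ : ℝ} (hτ : 0 < τ) :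
    ∀ᶠ n : ℕ in atTop, ∃! s : ℝ, IsThreshold n τ s := by
  have ha : 0 < 4 / τ ^ 2 := by positivity
  set a := 4 / τ ^ 2 with hadef
  have hlog : Tendsto (fun n : ℕ => a / 2 * Real.log n) atTop atTop :=
    (Real.tendsto_log_atTop.comp tendsto_natCast_atTop_atTop).const_mul_atTop (by positivity)
  filter_upwards [tendsto_natCast_atTop_atTop.eventually (eventually_logPhi_pos ha),
    tendsto_natCast_atTop_atTop.eventually (eventually_logPhi_neg ha),
    hlog.eventually_ge_atTop (Real.exp 1), eventually_logPhi_approx ha one_pos] with n h1 h2 h3 h4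
  have hL0 : 0 < a / 2 * Real.log n := (Real.exp_pos 1).trans_le h3
  have hle : a / 2 * Real.log n ≤ (n : ℝ) - 1 := by linarith [h4.2.2.1, h4.2.2.2]
  have hanti := logPhi_strictAntiOn ha h3
  obtain ⟨s, hs, hs0⟩ := intermediate_value_Icc' hle
    ((logPhi_continuousOn n a).mono fun x hx => ⟨hL0.trans_le hx.1, by linarith [hx.2]⟩)
    (show (0 : ℝ) ∈ Set.Icc _ _ from ⟨h2.le, (h1 _ hL0 le_rfl).le⟩)
  refine ⟨s, isThreshold_iff.2 ⟨hL0.trans_le hs.1, hs.2, hs0⟩, fun r hr => ?_⟩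
  obtain ⟨hr0, hr1, hr2⟩ := isThreshold_iff.1 hr
  have hrL : a / 2 * Real.log n ≤ r := by
    by_contra! hcon
    exact (h1 r hr0 hcon.le).ne' hr2
  exact hanti.injOn ⟨hrL, hr1⟩ hs (hr2.trans hs0.symm)

theorem tendsto_sub_thresholdApprox {τ : ℝ} (hτ : 0 < τ) {s : ℕ → ℝ}
    (hs : ∀ᶠ n : ℕ in atTop, IsThreshold n τ (s n)) :
    Tendsto (fun n => s n - thresholdApprox (4 / τ ^ 2) n) atTop (𝓝 0) := by
  have ha : 0 < 4 / τ ^ 2 := by positivity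
  set a := 4 / τ ^ 2 with hadef
  have hlog : Tendsto (fun n : ℕ => a / 2 * Real.log n) atTop atTop :=
    (Real.tendsto_log_atTop.comp tendsto_natCast_atTop_atTop).const_mul_atTop (by positivity)
  rw [Metric.tendsto_nhds]
  intro ε hε
  filter_upwards [hs, tendsto_natCast_atTop_atTop.eventually (eventually_logPhi_pos ha),
    hlog.eventually_ge_atTop (Real.exp 1), eventually_logPhi_approx ha hε] with n hsn h1 h3 h4
  obtain ⟨hr0, hr1, hr2⟩ := isThreshold_iff.1 hsn
  have hrL : a / 2 * Real.log n ≤ s n := by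
    by_contra! hcon
    exact (h1 _ hr0 hcon.le).ne' hr2
  have hanti := logPhi_strictAntiOn ha h3
  obtain ⟨p1, p2, p3, p4⟩ := h4
  rw [Real.dist_eq, sub_zero, abs_lt]
  constructor
  · have := (hanti.lt_iff_gt (a := s n) (b := thresholdApprox a n - ε) ⟨hrL, hr1⟩
      ⟨p3.le, by linarith⟩).1 (by rw [hr2]; exact p1)
    linarith
  · have := (hanti.lt_iff_gt (a := thresholdApprox a n + ε) (b := s n)
      ⟨by linarith, p4.le⟩ ⟨hrL, hr1⟩).1 (by rw [hr2]; exact p2)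
    linarith

/-! ### Almost sure events and the largest submatrix -/

theorem bddAbove_hasLargeAvg {n : ℕ} (τ : ℝ) (M : Matrix (Fin n) (Fin n) ℝ) :
    BddAbove {k : ℕ | HasLargeAvg τ M k} :=
  ⟨n, fun k ⟨A, _, hA, _⟩ => by simpa [hA] using A.card_le_univ⟩

theorem le_largestAvg {n : ℕ} {τ : ℝ} {M : Matrix (Fin n) (Fin n) ℝ} {k : ℕ}
    (h : HasLargeAvg τ M k) : k ≤ largestAvg τ M :=
  le_csSup (bddAbove_hasLargeAvg τ M) h

theorem hasLargeAvg_largestAvg {n : ℕ} {τ : ℝ} {M : Matrix (Fin n) (Fin n) ℝ}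
    (h : largestAvg τ M ≠ 0) : HasLargeAvg τ M (largestAvg τ M) := by
  refine Nat.sSup_mem ?_ (bddAbove_hasLargeAvg τ M)
  by_contra hne
  rw [Set.not_nonempty_iff_eq_empty] at hne
  exact h (by simp [largestAvg, hne])

theorem ae_eventually_notMem_of_summable {Ω : Type*} [MeasurableSpace Ω] {P : Measure Ω}
    [IsFiniteMeasure P] {B : ℕ → Set Ω} {f : ℕ → ℝ} (hf : Summable f)
    (hB : ∀ᶠ n in atTop, P.real (B n) ≤ f n) : ∀ᵐ ω ∂P, ∀ᶠ n in atTop, ω ∉ B n := by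
  classical
  -- The finitely many `n` for which the bound fails are discarded.
  set B' : ℕ → Set Ω := fun n => if P.real (B n) ≤ f n then B n else ∅ with hB'
  have h : ∑' n, P (B' n) ≠ ⊤ := by
    refine ne_top_of_le_ne_top hf.norm.tsum_ofReal_ne_top (ENNReal.tsum_le_tsum fun n => ?_)
    simp only [hB']
    split_ifs with h
    · rw [← ofReal_measureReal]
      exact ENNReal.ofReal_le_ofReal (h.trans (le_abs_self _))
    · simp
  filter_upwards [ae_eventually_notMem h] with ω hω
  filter_upwards [hω, hB] with n h1 h2
  simpa [hB', h2] using h1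

/-! ### Estimates for the first moment -/

theorem choose_le_exp {n k : ℕ} (hn : 1 ≤ n) (hk : 1 ≤ k) :
    (n.choose k : ℝ) ≤ Real.exp (k * (Real.log n + 1 - Real.log k)) := by
  have hn' : (0 : ℝ) < n := by exact_mod_cast hn
  have hk' : (0 : ℝ) < k := by exact_mod_cast hk
  have h1 := Nat.choose_le_pow_div (α := ℝ) k n
  have h2 := Real.pow_div_factorial_le_exp (k : ℝ) hk'.le k
  have e : ∀ x : ℝ, 0 < x → x ^ k = Real.exp (k * Real.log x) := fun x hx => by
    rw [Real.exp_nat_mul, Real.exp_log hx]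
  rw [e _ hk'] at h2
  rw [e _ hn'] at h1
  refine h1.trans ?_
  rw [show (k : ℝ) * (Real.log n + 1 - Real.log k) = k * Real.log n + (k - k * Real.log k) by ring,
    Real.exp_add, div_eq_mul_inv]
  gcongr
  rw [Real.exp_sub, le_div_iff₀ (by positivity), mul_comm]
  exact h2

theorem tendsto_log_thresholdApprox_sub {a : ℝ} (ha : 0 < a) (c : ℝ) :
    Tendsto (fun n : ℕ => Real.log (thresholdApprox a n + c) - Real.log (a * Real.log n))
      atTop (𝓝 0) := by
  have h := (Real.continuousAt_log one_ne_zero).tendsto.comp (tendsto_thresholdApprox_add_div ha c)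
  rw [Real.log_one] at h
  have hlog : Tendsto (fun n : ℕ => a * Real.log n) atTop atTop :=
    (Real.tendsto_log_atTop.comp tendsto_natCast_atTop_atTop).const_mul_atTop ha
  refine h.congr' ?_
  filter_upwards [hlog.eventually_gt_atTop 0,
    (tendsto_thresholdApprox_add_div ha c).eventually_const_lt (show (0 : ℝ) < 1 by norm_num)]
    with n h1 h2
  have h3 := (div_pos_iff_of_pos_right h1).1 h2
  exact Real.log_div h3.ne' h1.ne'

theorem tendsto_thresholdApprox {a : ℝ} (ha : 0 < a) :
    Tendsto (thresholdApprox a) atTop atTop := by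
  have hlog : Tendsto (fun n : ℕ => a * Real.log n) atTop atTop :=
    (Real.tendsto_log_atTop.comp tendsto_natCast_atTop_atTop).const_mul_atTop ha
  refine ((tendsto_thresholdApprox_add_div ha 0).pos_mul_atTop one_pos hlog).congr' ?_
  filter_upwards [hlog.eventually_gt_atTop 0] with n h
  rw [add_zero, div_mul_cancel₀ _ h.ne']

/-- The margin `19 / 10` stands for any number below `2`: it leaves room for the difference between
the threshold and its approximation. -/
theorem eventually_first_moment_le {τ : ℝ} (hτ : 0 < τ) :
    ∀ᶠ n : ℕ in atTop, ∀ k : ℕ, thresholdApprox (4 / τ ^ 2) n + 19 / 10 ≤ k →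
      ((n.choose k : ℝ) * Real.exp (-(τ ^ 2 * (k : ℝ) ^ 2 / 4))) ^ 2 ≤
        Real.exp (-(3 * Real.log n)) := by
  have ha : 0 < 4 / τ ^ 2 := by positivity
  set a := 4 / τ ^ 2 with hadef
  have hlog : Tendsto (fun n : ℕ => a * Real.log n) atTop atTop :=
    (Real.tendsto_log_atTop.comp tendsto_natCast_atTop_atTop).const_mul_atTop ha
  filter_upwards [(tendsto_log_thresholdApprox_sub ha (19 / 10)).eventually_const_lt
      (show -(1 / (10 * a)) < 0 by have : 0 < 1 / (10 * a) := by positivity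
                                   linarith),
    (tendsto_thresholdApprox_add_div ha (19 / 10)).eventually_const_lt
      (show (9 / 10 : ℝ) < 1 by norm_num), hlog.eventually_gt_atTop 0,
    (tendsto_thresholdApprox ha).eventually_ge_atTop 0, eventually_ge_atTop 1]
    with n h1 h2 h3 h4 hn k hk
  set ℓ := Real.log n with hℓ
  rw [lt_div_iff₀ h3] at h2
  have hx0 : (0 : ℝ) < k := by linarith
  have hk1 : 1 ≤ k := by exact_mod_cast hx0
  have hle := Real.log_le_log (by linarith) hk
  have hT : (thresholdApprox a n + 19 / 10) / a = ℓ - Real.log (a * ℓ) + 1 + 19 / (10 * a) := by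
    rw [thresholdApprox, ← hℓ]; field_simp
  have hka : (thresholdApprox a n + 19 / 10) / a ≤ k / a := by gcongr
  have e1 : 19 / (10 * a) - 1 / (10 * a) = 18 / (10 * a) := by field_simp; norm_num
  have hexp : ℓ + 1 - Real.log k - k / a ≤ -(18 / (10 * a)) := by linarith
  have e2 : τ ^ 2 * (k : ℝ) ^ 2 / 4 = k * (k / a) := by rw [hadef]; field_simp
  calc _ ≤ (Real.exp (k * (ℓ + 1 - Real.log k)) * Real.exp (-(τ ^ 2 * (k : ℝ) ^ 2 / 4))) ^ 2 := by
        gcongr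
        exact choose_le_exp hn hk1
    _ = Real.exp (2 * (k * (ℓ + 1 - Real.log k - k / a))) := by
        rw [← Real.exp_add, ← Real.exp_nat_mul, e2]
        congr 1; push_cast; ring
    _ ≤ _ := by
        rw [Real.exp_le_exp]
        have h5 : (k : ℝ) * (ℓ + 1 - Real.log k - k / a) ≤ k * (-(18 / (10 * a))) := by gcongr
        have h6 : 9 / 10 * ℓ ≤ k / a := by rw [le_div_iff₀ ha]; linarith
        have h7 : (k : ℝ) * (-(18 / (10 * a))) = -(18 / 10) * (k / a) := by field_simp
        have h8 : 0 < ℓ := pos_of_mul_pos_right h3 ha.le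
        linarith

/-! ### Estimates for the second moment -/

/-- Each term of the second moment sum is at most `n ^ (-3 / 4)`. Put `m = ln (n / k)`,
`δ = 3 ln 2 + τ ^ 2 / 2` and `A = 2 k r² / (k² + r²) ≤ r`. Since `τ² k / 4 ≤ m - δ`, the term is at
most `C(k, r) exp (-(r - A) m - δ A)`. Unless `r` is close to `k`, the gap
`r - A = r (k - r)² / (k² + r²)` makes the factor `exp (-(r - A) m)` decisive; for `r` close to `k`
it is `exp (-δ A)` with `A` close to `k`, in which the `3 ln 2` beats `C(k, r) ≤ 2 ^ k` and the
`τ ^ 2 / 2` yields a power of `n`. The bounds `3000` and `8000` are what the intermediate range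
of `r` requires. -/
theorem overlap_term_le {n k r : ℕ} {τ : ℝ} (hτ : 0 < τ) (hr : 1 ≤ r) (hrk : r ≤ k)
    (hn : 1 ≤ n) (hk : 3000 ≤ k) (hℓ : 8000 ≤ Real.log n)
    (hlogk : Real.log k ≤ Real.log n / 100)
    (hlow : 9 / 10 * Real.log n ≤ τ ^ 2 * k / 4)
    (hup : τ ^ 2 * k / 4 ≤ Real.log n - Real.log k - (3 * Real.log 2 + τ ^ 2 / 2)) :
    (k.choose r : ℝ) * ((k : ℝ) / n) ^ r *
      Real.exp (τ ^ 2 * (k : ℝ) ^ 2 * ((r : ℝ) ^ 2 / ((k : ℝ) ^ 2 + (r : ℝ) ^ 2)) / 2) ≤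
      Real.exp (-(3 / 4 * Real.log n)) := by
  set ℓ := Real.log n with hℓdef
  have hx : (3000 : ℝ) ≤ k := by exact_mod_cast hk
  have hr1 : (1 : ℝ) ≤ r := by exact_mod_cast hr
  have hrx : (r : ℝ) ≤ k := by exact_mod_cast hrk
  have hn' : (0 : ℝ) < n := by exact_mod_cast hn
  have hk' : (0 : ℝ) < k := by linarith
  set m := ℓ - Real.log k with hm
  set δ := 3 * Real.log 2 + τ ^ 2 / 2 with hδ
  set A : ℝ := 2 * k * (r : ℝ) ^ 2 / ((k : ℝ) ^ 2 + (r : ℝ) ^ 2) with hA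
  have hl2 : 0 < Real.log 2 := Real.log_pos (by norm_num)
  have hl2' : Real.log 2 < 1 := by linarith [Real.log_two_lt_d9]
  have hA0 : 0 ≤ A := by positivity
  have hm0 : 99 / 100 * ℓ ≤ m := by linarith
  have hrA : r - A = r * ((k : ℝ) - r) ^ 2 / ((k : ℝ) ^ 2 + (r : ℝ) ^ 2) := by
    rw [hA]; field_simp; ring
  have hden : (0 : ℝ) < (k : ℝ) ^ 2 + (r : ℝ) ^ 2 := by positivity
  have hrA0 : 0 ≤ r - A := by rw [hrA]; positivity
  have e1 : ((k : ℝ) / n) ^ r = Real.exp (-(r * m)) := by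
    rw [← Real.exp_log (show (0 : ℝ) < k / n by positivity), ← Real.exp_nat_mul,
      Real.log_div hk'.ne' hn'.ne']
    congr 1; rw [hm]; ring
  have e2 : τ ^ 2 * (k : ℝ) ^ 2 * ((r : ℝ) ^ 2 / ((k : ℝ) ^ 2 + (r : ℝ) ^ 2)) / 2 =
      τ ^ 2 * k / 4 * A := by rw [hA]; field_simp; norm_num
  have hbase : ((k : ℝ) / n) ^ r *
      Real.exp (τ ^ 2 * (k : ℝ) ^ 2 * ((r : ℝ) ^ 2 / ((k : ℝ) ^ 2 + (r : ℝ) ^ 2)) / 2) ≤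
      Real.exp (-((r - A) * m) - δ * A) := by
    rw [e1, e2, ← Real.exp_add, Real.exp_le_exp]
    have := mul_le_mul_of_nonneg_right hup hA0
    linarith
  have hch2 : (k.choose r : ℝ) ≤ Real.exp (k * Real.log 2) := by
    rw [Real.exp_nat_mul, Real.exp_log two_pos]
    exact_mod_cast Nat.choose_le_two_pow k r
  rw [mul_assoc]
  have fin : ∀ B : ℝ, (k.choose r : ℝ) ≤ Real.exp B →
      B - (r - A) * m - δ * A ≤ -(3 / 4 * ℓ) → (k.choose r : ℝ) * (((k : ℝ) / n) ^ r *
      Real.exp (τ ^ 2 * (k : ℝ) ^ 2 * ((r : ℝ) ^ 2 / ((k : ℝ) ^ 2 + (r : ℝ) ^ 2)) / 2)) ≤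
      Real.exp (-(3 / 4 * ℓ)) := fun B h1 h2 => by
    calc _ ≤ Real.exp B * Real.exp (-((r - A) * m) - δ * A) :=
          mul_le_mul h1 hbase (by positivity) (by positivity)
      _ ≤ _ := by rw [← Real.exp_add, Real.exp_le_exp]; linarith
  have hδA : 0 ≤ δ * A := mul_nonneg (by positivity) hA0
  -- Small overlaps: `r - A ≥ 0.8 r`, and `C(k, r) ≤ k ^ r`.
  rcases le_total (10 * (r : ℝ)) k with hc1 | hc1
  · refine fin (r * Real.log k) ?_ ?_
    · rw [Real.exp_nat_mul, Real.exp_log hk']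
      exact_mod_cast Nat.choose_le_pow k r
    · have h1 : 8 / 10 * r ≤ r - A := by
        rw [hrA, le_div_iff₀ hden]
        have h3 : 8 / 10 * ((k : ℝ) ^ 2 + (r : ℝ) ^ 2) ≤ ((k : ℝ) - r) ^ 2 := by
          have h4 : 0 ≤ (k : ℝ) * (k - 10 * r) := mul_nonneg hk'.le (sub_nonneg.2 hc1)
          have h5 := sq_nonneg (r : ℝ)
          linarith
        have h6 := mul_le_mul_of_nonneg_left h3 (zero_le_one.trans hr1)
        linarith
      have h2 : 8 / 10 * r * m ≤ (r - A) * m := mul_le_mul_of_nonneg_right h1 (by linarith)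
      have h3 : (r : ℝ) * (Real.log k - 8 / 10 * m) ≤ r * (-(3 / 4 * ℓ)) :=
        mul_le_mul_of_nonneg_left (by linarith) (by linarith)
      have h4 : 1 * (3 / 4 * ℓ) ≤ r * (3 / 4 * ℓ) :=
        mul_le_mul_of_nonneg_right hr1 (by linarith)
      linarith
  · have hsq : (k : ℝ) ^ 2 + (r : ℝ) ^ 2 ≤ 2 * (k : ℝ) ^ 2 := by
      have := pow_le_pow_left₀ (by linarith) hrx 2
      linarith
    refine fin (k * Real.log 2) hch2 ?_
    -- Intermediate overlaps: `r - A ≥ k / 2000`, so the term is smaller than any power of `n`.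
    rcases le_total (10 * (r : ℝ)) (9 * k) with hc2 | hc2
    · have h1 : (k : ℝ) / 2000 ≤ r - A := by
        rw [hrA, le_div_iff₀ hden]
        have h3 : (k : ℝ) ^ 2 / 100 ≤ ((k : ℝ) - r) ^ 2 := by
          have := pow_le_pow_left₀ (show (0 : ℝ) ≤ k / 10 by linarith)
            (show (k : ℝ) / 10 ≤ k - r by linarith) 2
          linarith
        calc (k : ℝ) / 2000 * ((k : ℝ) ^ 2 + (r : ℝ) ^ 2) ≤ k / 2000 * (2 * (k : ℝ) ^ 2) := by
              gcongr
          _ = k / 10 * ((k : ℝ) ^ 2 / 100) := by ring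
          _ ≤ r * ((k : ℝ) - r) ^ 2 := by
              apply mul_le_mul (by linarith) h3 (by positivity) (by linarith)
      have h2 : (k : ℝ) / 2000 * m ≤ (r - A) * m := mul_le_mul_of_nonneg_right h1 (by linarith)
      have h3 : (k : ℝ) * Real.log 2 ≤ k * 1 := by gcongr
      have h4 : (k : ℝ) * (99 / 100 * ℓ) ≤ k * m := mul_le_mul_of_nonneg_left hm0 hk'.le
      have h5 : (k : ℝ) * 8000 ≤ k * ℓ := mul_le_mul_of_nonneg_left hℓ hk'.le
      have h6 : 3000 * ℓ ≤ k * ℓ := mul_le_mul_of_nonneg_right hx (by linarith)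
      linarith
    -- Large overlaps: `A ≥ 0.81 k`.
    · have h1 : 81 / 100 * k ≤ A := by
        rw [hA, le_div_iff₀ hden]
        have h5 : 81 / 100 * (k : ℝ) ^ 2 ≤ (r : ℝ) ^ 2 := by
          have := pow_le_pow_left₀ (show (0 : ℝ) ≤ 9 / 10 * k by linarith)
            (show 9 / 10 * (k : ℝ) ≤ r by linarith) 2
          linarith
        calc 81 / 100 * (k : ℝ) * ((k : ℝ) ^ 2 + (r : ℝ) ^ 2)
            ≤ 81 / 100 * (k : ℝ) * (2 * (k : ℝ) ^ 2) := by gcongr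
          _ = 2 * k * (81 / 100 * (k : ℝ) ^ 2) := by ring
          _ ≤ _ := by gcongr
      have h2 : δ * (81 / 100 * k) ≤ δ * A := by gcongr
      have h3 : 0 ≤ (r - A) * m := mul_nonneg hrA0 (by linarith)
      have h4 : 0 < k * Real.log 2 := by positivity
      have h5 : δ * (81 / 100 * k) = 243 / 100 * (k * Real.log 2) + 162 / 100 * (τ ^ 2 * k / 4) := by
        rw [hδ]; ring
      linarith

theorem second_moment_bound_le {n k : ℕ} {τ : ℝ} (hτ : 0 < τ)
    (hn : 1 ≤ n) (hk : 3000 ≤ k) (hℓ : 8000 ≤ Real.log n)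
    (hlogk : Real.log k ≤ Real.log n / 100)
    (hlow : 9 / 10 * Real.log n ≤ τ ^ 2 * k / 4)
    (hup : τ ^ 2 * k / 4 ≤ Real.log n - Real.log k - (3 * Real.log 2 + τ ^ 2 / 2))
    {c : ℝ} (hc : 0 < c) :
    (τ * k / c * ∑ r ∈ Finset.Icc 1 k, (k.choose r : ℝ) * ((k : ℝ) / n) ^ r *
      Real.exp (τ ^ 2 * (k : ℝ) ^ 2 * ((r : ℝ) ^ 2 / ((k : ℝ) ^ 2 + (r : ℝ) ^ 2)) / 2)) ^ 2 ≤
      (τ / c) ^ 2 * Real.exp (-(7 / 5 * Real.log n)) := by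
  have hk' : (0 : ℝ) < k := by exact_mod_cast (by omega : 0 < k)
  have hsum : ∑ r ∈ Finset.Icc 1 k, (k.choose r : ℝ) * ((k : ℝ) / n) ^ r *
      Real.exp (τ ^ 2 * (k : ℝ) ^ 2 * ((r : ℝ) ^ 2 / ((k : ℝ) ^ 2 + (r : ℝ) ^ 2)) / 2) ≤
      k * Real.exp (-(3 / 4 * Real.log n)) := by
    refine (Finset.sum_le_card_nsmul _ _ (Real.exp (-(3 / 4 * Real.log n))) fun r hr => ?_).trans_eq
      (by simp)
    rw [Finset.mem_Icc] at hr
    exact overlap_term_le hτ hr.1 hr.2 hn hk hℓ hlogk hlow hup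
  have hkk : (k : ℝ) ≤ Real.exp (Real.log n / 100) := by
    rwa [← Real.log_le_iff_le_exp hk']
  calc _ ≤ (τ * Real.exp (Real.log n / 100) / c *
        (Real.exp (Real.log n / 100) * Real.exp (-(3 / 4 * Real.log n)))) ^ 2 := by
        gcongr
        exact hsum.trans (by gcongr)
    _ = (τ / c) ^ 2 * Real.exp (-(146 / 100 * Real.log n)) := by
        rw [show τ * Real.exp (Real.log n / 100) / c *
          (Real.exp (Real.log n / 100) * Real.exp (-(3 / 4 * Real.log n))) = τ / c *
          (Real.exp (Real.log n / 100) * (Real.exp (Real.log n / 100) *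
            Real.exp (-(3 / 4 * Real.log n)))) by ring, mul_pow, ← Real.exp_add, ← Real.exp_add,
          ← Real.exp_nat_mul]
        congr 2; push_cast; ring
    _ ≤ _ := by
        refine mul_le_mul_of_nonneg_left (Real.exp_le_exp.2 ?_) (sq_nonneg _)
        linarith

theorem summable_exp_neg_mul_log {c : ℝ} (hc : 1 < c) :
    Summable fun n : ℕ => Real.exp (-(c * Real.log n)) := by
  -- The index `0` is skipped, since there `Real.log 0 = 0` and the term is not a power of `n`.
  refine (summable_nat_add_iff 1).1 ?_
  refine ((summable_nat_add_iff 1).2 (Real.summable_nat_rpow.2 (show -c < -1 by linarith))).congr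
    fun n => ?_
  rw [Real.rpow_def_of_pos (by positivity)]
  congr 1
  ring

/-- A size within a bounded distance of the threshold and below it by `a (1 + 3 ln 2) + 2.9`
eventually satisfies the hypotheses of the second moment estimates. -/
theorem eventually_size_conditions {τ : ℝ} (hτ : 0 < τ) {k : ℕ → ℕ}
    (hup : ∀ᶠ n : ℕ in atTop, (k n : ℝ) ≤ thresholdApprox (4 / τ ^ 2) n -
      4 / τ ^ 2 * (1 + 3 * Real.log 2) - 29 / 10)
    {b : ℝ} (hlow : ∀ᶠ n : ℕ in atTop, thresholdApprox (4 / τ ^ 2) n + b ≤ k n) :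
    ∀ᶠ n : ℕ in atTop, 1 ≤ n ∧ k n ≤ n ∧ 3000 ≤ k n ∧ 8000 ≤ Real.log n ∧ 1 ≤ τ * k n ∧
      Real.log (k n) ≤ Real.log n / 100 ∧ 9 / 10 * Real.log n ≤ τ ^ 2 * k n / 4 ∧
      τ ^ 2 * k n / 4 ≤ Real.log n - Real.log (k n) - (3 * Real.log 2 + τ ^ 2 / 2) := by
  have ha : 0 < 4 / τ ^ 2 := by positivity
  set a := 4 / τ ^ 2 with hadef
  have hl : Tendsto (fun n : ℕ => Real.log n) atTop atTop :=
    Real.tendsto_log_atTop.comp tendsto_natCast_atTop_atTop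
  have hll := (tendsto_log_log_mul_div_log (show 0 < 2 * a by positivity)).comp
    (tendsto_natCast_atTop_atTop (R := ℝ))
  have hτ2 : τ ^ 2 = 4 / a := by rw [hadef]; field_simp
  filter_upwards [hup, hlow, eventually_ge_atTop 1, hl.eventually_ge_atTop 8000,
    hll.eventually_lt_const (show (0 : ℝ) < 1 / 100 by norm_num),
    (tendsto_thresholdApprox_add_div ha b).eventually_const_lt (show (9 / 10 : ℝ) < 1 by norm_num),
    (tendsto_thresholdApprox_add_div ha 0).eventually_lt_const (show (1 : ℝ) < 2 by norm_num),
    (tendsto_thresholdApprox ha).eventually_ge_atTop (3000 + 1 / τ - b),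
    (tendsto_log_thresholdApprox_sub ha 0).eventually_lt_const
      (show (0 : ℝ) < 9 / (10 * a) by positivity)]
    with n h1 h2 h3 h4 h5 h6 h7 h8 h9
  have hn : (0 : ℝ) < n := by exact_mod_cast h3
  set ℓ := Real.log n with hℓ
  have hℓ0 : 0 < ℓ := by linarith
  have hτi : 0 < 1 / τ := by positivity
  have hx3 : (3000 : ℝ) ≤ k n := by linarith
  have hl2 : 0 < Real.log 2 := Real.log_pos (by norm_num)
  have hT : (k n : ℝ) ≤ thresholdApprox a n := by
    have : 0 < a * (1 + 3 * Real.log 2) := by positivity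
    linarith
  rw [lt_div_iff₀ (by positivity)] at h6
  rw [add_zero, div_lt_iff₀ (by positivity)] at h7
  rw [add_zero] at h9
  simp only [Function.comp] at h5
  rw [div_lt_iff₀ hℓ0] at h5
  have hlogk : Real.log (k n) ≤ ℓ / 100 := by
    have := Real.log_le_log (by linarith) (show (k n : ℝ) ≤ 2 * a * ℓ by linarith)
    linarith
  have e3 : τ ^ 2 * k n / 4 = k n / a := by rw [hτ2]; field_simp
  refine ⟨h3, ?_, by exact_mod_cast hx3, h4, ?_, hlogk, ?_, ?_⟩
  · have : (k n : ℝ) ≤ n := (Real.log_le_log_iff (by linarith) hn).1 (by linarith)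
    exact_mod_cast this
  · have : 1 / τ ≤ k n := by linarith
    rwa [div_le_iff₀ hτ, mul_comm] at this
  · rw [e3, le_div_iff₀ ha]; linarith
  · have h10 := Real.log_le_log (by linarith) hT
    have h11 : (k n : ℝ) / a ≤ (thresholdApprox a n - a * (1 + 3 * Real.log 2) - 29 / 10) / a := by
      gcongr
    have h12 : (thresholdApprox a n - a * (1 + 3 * Real.log 2) - 29 / 10) / a =
        ℓ - Real.log (a * ℓ) - 3 * Real.log 2 - 9 / (10 * a) - 4 / a / 2 := by
      rw [thresholdApprox]; field_simp; ring
    rw [e3, hτ2]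
    linarith

/-! ### Conclusion -/

theorem theorem1 {Ω : Type*} [MeasurableSpace Ω] (P : Measure Ω) [IsProbabilityMeasure P]
    (w : ℕ → ℕ → Ω → ℝ)
    (hlaw : ∀ i j : ℕ, HasLaw (w i j) (gaussianReal 0 1) P)
    (hindep : iIndepFun (fun (p : ℕ × ℕ) => w p.1 p.2) P)
    (τ : ℝ) (hτ : 0 < τ) :
    (∀ᶠ n : ℕ in atTop, ∃! s : ℝ, IsThreshold n τ s) ∧
    ∀ s : ℕ → ℝ, (∀ᶠ n : ℕ in atTop, IsThreshold n τ (s n)) →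
      Tendsto
        (fun n : ℕ => s n - (4 / τ ^ 2 * Real.log n
          - 4 / τ ^ 2 * Real.log (4 / τ ^ 2 * Real.log n) + 4 / τ ^ 2)) atTop (𝓝 0) ∧
      ∀ᵐ ω ∂P, ∀ᶠ n : ℕ in atTop,
        s n - 4 / τ ^ 2 - 12 * Real.log 2 / τ ^ 2 - 4
            ≤ (largestAvg τ (corner (fun i j => w i j ω) n) : ℝ) ∧
        (largestAvg τ (corner (fun i j => w i j ω) n) : ℝ) ≤ s n + 2 := by
  refine ⟨eventually_existsUnique_isThreshold hτ, fun s hs => ?_⟩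
  have hsT := tendsto_sub_thresholdApprox hτ hs
  refine ⟨hsT, ?_⟩
  have ha : 0 < 4 / τ ^ 2 := by positivity
  have hX : ∀ n, ∀ p : Fin n × Fin n, HasLaw (fun ω => w p.1 p.2 ω) (gaussianReal 0 1) P :=
    fun n p => hlaw _ _
  have hind : ∀ n, iIndepFun (fun (p : Fin n × Fin n) ω => w p.1 p.2 ω) P := fun n =>
    hindep.precomp (g := fun p : Fin n × Fin n => ((p.1 : ℕ), (p.2 : ℕ)))
      fun p q h => by
        simp only [Prod.mk.injEq] at h
        exact Prod.ext (Fin.ext h.1) (Fin.ext h.2)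
  have hupper : ∀ᵐ ω ∂P, ∀ᶠ n : ℕ in atTop, ω ∉ ⋃ k ∈ (Finset.Icc 1 n).filter
      (fun k : ℕ => thresholdApprox (4 / τ ^ 2) n + 19 / 10 ≤ k),
      {ω | HasLargeAvg τ (corner (fun i j => w i j ω) n) k} := by
    refine ae_eventually_notMem_of_summable (summable_exp_neg_mul_log one_lt_two) ?_
    filter_upwards [eventually_first_moment_le hτ, eventually_ge_atTop 1] with n h1 h2
    have hn : (0 : ℝ) < n := by exact_mod_cast h2
    refine (measureReal_biUnion_finset_le _ _).trans ?_
    calc _ ≤ ∑ k ∈ (Finset.Icc 1 n).filter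
          (fun k : ℕ => thresholdApprox (4 / τ ^ 2) n + 19 / 10 ≤ k),
            Real.exp (-(3 * Real.log n)) := by
          refine Finset.sum_le_sum fun k hk => ?_
          rw [Finset.mem_filter, Finset.mem_Icc] at hk
          exact (measure_hasLargeAvg_le (hX n) (hind n) hτ hk.1.1).trans (h1 k hk.2)
      _ ≤ n * Real.exp (-(3 * Real.log n)) := by
          rw [Finset.sum_const, nsmul_eq_mul]
          gcongr
          exact (Finset.card_filter_le _ _).trans (by simp)
      _ = Real.exp (-(2 * Real.log n)) := by
          nth_rewrite 1 [← Real.exp_log hn]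
          rw [← Real.exp_add]
          congr 1; ring
  set b : ℝ := 4 / τ ^ 2 * (1 + 3 * Real.log 2) + 4 with hb
  -- `k n` is the least integer above the lower bound; it exceeds that bound by less than `1`, hence
  -- stays below `s n` by more than `b - 1`.
  set k : ℕ → ℕ := fun n => ⌈s n - b⌉₊ with hk
  have hsize := eventually_size_conditions hτ (k := k) (b := -(b + 1 / 10)) (by
    filter_upwards [hsT.eventually_lt_const (show (0 : ℝ) < 1 / 10 by norm_num),
      hsT.eventually_const_lt (show (-1 : ℝ) < 0 by norm_num),
      (tendsto_thresholdApprox ha).eventually_ge_atTop (b + 1)] with n h1 h2 h3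
    have := Nat.ceil_lt_add_one (show 0 ≤ s n - b by linarith)
    simp only [hk]
    linarith) (by
    filter_upwards [hsT.eventually_const_lt (show (-(1 / 10) : ℝ) < 0 by norm_num)] with n h1
    have := Nat.le_ceil (s n - b)
    simp only [hk]
    linarith)
  have hlower : ∀ᵐ ω ∂P, ∀ᶠ n : ℕ in atTop,
      ω ∉ {ω | ¬ HasLargeAvg τ (corner (fun i j => w i j ω) n) (k n)} := by
    refine ae_eventually_notMem_of_summable
      ((summable_exp_neg_mul_log (show (1 : ℝ) < 7 / 5 by norm_num)).mul_left
        ((τ / (Real.exp (-(3 / 2)) / √(2 * Real.pi))) ^ 2)) ?_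
    filter_upwards [hsize] with n ⟨h1, h2, h3, h4, h5, h6, h7, h8⟩
    exact (measure_not_hasLargeAvg_le (hX n) (hind n) hτ (by omega) h2 h5).trans
      (second_moment_bound_le hτ h1 h3 h4 h6 h7 h8 (by positivity))
  filter_upwards [hupper, hlower] with ω h1 h2
  filter_upwards [h1, h2, hsT.eventually_const_lt (show (-(1 / 10) : ℝ) < 0 by norm_num),
    (tendsto_thresholdApprox ha).eventually_ge_atTop 0] with n h1 h2 h3 h4
  constructor
  · have h5 : k n ≤ _ := le_largestAvg (not_not.1 h2)
    have h6 : (k n : ℝ) ≤ largestAvg τ (corner (fun i j => w i j ω) n) := by exact_mod_cast h5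
    have h7 := Nat.le_ceil (s n - b)
    have h8 : b = 4 / τ ^ 2 + 12 * Real.log 2 / τ ^ 2 + 4 := by rw [hb]; ring
    simp only [hk] at h6
    linarith
  · by_contra! hcon
    set K := largestAvg τ (corner (fun i j => w i j ω) n) with hK
    have hK0 : K ≠ 0 := by
      intro h0
      rw [h0, Nat.cast_zero] at hcon
      linarith
    have hKl := hasLargeAvg_largestAvg hK0
    apply h1
    simp only [Set.mem_iUnion]
    refine ⟨K, Finset.mem_filter.2 ⟨Finset.mem_Icc.2 ⟨by omega, ?_⟩, by linarith⟩, hKl⟩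
    obtain ⟨A, _, hA, _⟩ := hKl
    rw [hK, ← hA]
    simpa using A.card_le_univ
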